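/- Let $u=(u^1,\dots,u^N)$ depend on $t$ and $x=(x^1,\dots,x^n)$, with jet coordinates $u^\sigma_{k,I}$ standing for $\partial_t^k\partial_x^I u^\sigma$ ($I$ a multi-index in $x$; $u^\sigma_I=u^\sigma_{0,I}$), let $D_t,D_i$ be the total derivatives, and $D_I=D_1^{I_1}\cdots D_n^{I_n}$. Consider a first-order Cauchy–Kovalevskaya system $$G^\sigma=u^\sigma_t+g^\sigma(t,x,u,\partial_xu,\dots,\partial_x^mu)=0,\qquad \sigma=1,\dots,N,$$ and expressions $\Lambda_\sigma(t,x,u,\partial_xu,\dots,\partial_x^pu)$, $\sigma=1,\dots,N$ (no dependence on $u_t$ and its differential consequences). All expressions are smooth functions of finitely many jet coordinates on a fixed open set $U$ of jet space of the following kind: the set $B$ of points $(t,x)$ over which $U$ lies is star-shaped about one of its points, and for some smooth $v=(v^1,\dots,v^N)$ on $B$ the fibre of $U$ over each $(t,x)\in B$ is star-shaped about the jet of $v$ at $(t,x)$ (for example the whole jet space, with $v=0$). For an expression $F$ put $$(\mathcal L_F)_\rho V=\sum_I \frac{\partial F}{\partial u^\rho_I}D_IV,\qquad (\mathcal L_F^*)_\rho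 W=\sum_I(-1)^{|I|}D_I\Big(\frac{\partial F}{\partial u^\rho_I}W\Big).$$ Say that $\Lambda$ is - a *set of multipliers* if $\sum_\sigma(u^\sigma_t+g^\sigma)\Lambda_\sigma=D_t\Phi^t+\sum_iD_i\Phi^i$ identically on $U$, for some $\Phi^t,\Phi^i$ depending on $t,x,u$ and finitely many derivatives of $u$ with respect to $t$ and $x$; - an *adjoint symmetry* if $-\mathcal D_t\Lambda_\sigma+\sum_\rho(\mathcal L_{g^\rho}^*)_\sigma\Lambda_\rho=0$ on $U$ for all $\sigma$, where $\mathcal D_t=\partial_t-\sum_{\rho,I}(D_Ig^\rho)\,\partial/\partial u^\rho_I$ is the total $t$-derivative on the solution space; - *variational* if $\Lambda_\sigma=\sum_I(-1)^{|I|}D_I(\partial P/\partial u^\sigma_I)$ on $U$ for all $\sigma$, for some $P$ depending on $t,x,u$ and finitely many $x$-derivatives of $u$. Then: 1. $\Lambda$ is a set of multipliers if and only if it is an adjoint symmetry and is variational. 2. $\Lambda$ is a set of multipliers if and only if it is an adjoint symmetry and its linearization operator is self-adjoint, that is, $(\mathcal L_{\Lambda_\sigma})_\rho V=(\mathcal L^*_{\Lambda_\rho})_\sigma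 V$ on $U$ for all $\sigma,\rho$ and all $V$ depending smoothly on $t,x,u$ and finitely many derivatives of $u$ (Helmholtz conditions). 3. $\Lambda$ is variational if and only if its linearization operator is self-adjoint. 4. The linearization operator of $\Lambda$ is self-adjoint if and only if the extra determining equations hold on $U$: for all $\sigma,\rho$ and all $I$ with $|I|\le p$, $$(-1)^{|I|+1}\frac{\partial\Lambda_\sigma}{\partial u^\rho_I}+\sum_{J}(-1)^{|J|}\binom{I+J}{I}D_J\frac{\partial\Lambda_\rho}{\partial u^\sigma_{I+J}}=0,\qquad \binom{I+J}{I}=\prod_{i}\binom{I_i+J_i}{I_i}.$$ -/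

import Mathlib

open scoped ContDiff

noncomputable section

namespace CauchyKovalevskaya

/-! Jet coordinates for `N` dependent variables `u^1, …, u^N` of the independent variables
`t` and `x = (x^1, …, x^n)`. Sums over jet coordinates and multi-indices are written as `∑ᶠ`;
for a differential function they have only finitely many nonzero terms. -/

/-- The index `(σ, k, I)` names the jet coordinate `u^σ_{k,I}`, which stands for
`∂_t^k ∂_{x^1}^{I_1} ⋯ ∂_{x^n}^{I_n} u^σ`. -/
abbrev JetIdx (n N : ℕ) : Type := Fin N × ℕ × (Fin n → ℕ)

/-- The (infinite) jet space: points `(t, x, (u^σ_{k,I}))`, with the product topology. -/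
abbrev Jet (n N : ℕ) : Type := ℝ × (Fin n → ℝ) × (JetIdx n N → ℝ)

variable {n N : ℕ}

/-- The order of a multi-index of `x`-derivatives. -/
def order (I : Fin n → ℕ) : ℕ := ∑ i, I i

/-- Restriction of a jet to finitely many of the derivative coordinates. -/
def trunc (S : Finset (JetIdx n N)) (z : Jet n N) : ℝ × (Fin n → ℝ) × (S → ℝ) :=
  (z.1, z.2.1, fun c => z.2.2 c)

/-- `F` is, on `U`, a smooth function of `t`, `x` and finitely many derivatives of `u`
(`t`-derivatives allowed). -/
def IsDiffFun (U : Set (Jet n N)) (F : Jet n N → ℝ) : Prop :=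
  ∃ S : Finset (JetIdx n N), ∃ f : ℝ × (Fin n → ℝ) × (S → ℝ) → ℝ,
    ContDiffOn ℝ ∞ f (trunc S '' U) ∧ ∀ z ∈ U, F z = f (trunc S z)

/-- `F` is, on `U`, a smooth function of `t`, `x` and the `x`-derivatives of `u` of order at
most `p`; there is no dependence on `u_t` and its differential consequences. -/
def IsSpatialDiffFun (U : Set (Jet n N)) (p : ℕ) (F : Jet n N → ℝ) : Prop :=
  ∃ S : Finset (JetIdx n N), (∀ c ∈ S, c.2.1 = 0 ∧ order c.2.2 ≤ p) ∧
    ∃ f : ℝ × (Fin n → ℝ) × (S → ℝ) → ℝ,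
      ContDiffOn ℝ ∞ f (trunc S '' U) ∧ ∀ z ∈ U, F z = f (trunc S z)

/-! ### Partial and total derivatives -/

/-- `∂F/∂t`, all other jet coordinates being held fixed. -/
def partialT (F : Jet n N → ℝ) (z : Jet n N) : ℝ :=
  deriv (fun s => F (s, z.2)) z.1

/-- `∂F/∂x^i`, all other jet coordinates being held fixed. -/
def partialX (i : Fin n) (F : Jet n N → ℝ) (z : Jet n N) : ℝ :=
  deriv (fun s => F (z.1, Function.update z.2.1 i s, z.2.2)) (z.2.1 i)

/-- `∂F/∂u^σ_{k,I}` with `c = (σ, k, I)`, all other jet coordinates being held fixed. -/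
def partialU (c : JetIdx n N) (F : Jet n N → ℝ) (z : Jet n N) : ℝ :=
  deriv (fun s => F (z.1, z.2.1, Function.update z.2.2 c s)) (z.2.2 c)

/-- The total derivative `D_t`. -/
def totalT (F : Jet n N → ℝ) (z : Jet n N) : ℝ :=
  partialT F z + ∑ᶠ c : JetIdx n N, z.2.2 (c.1, c.2.1 + 1, c.2.2) * partialU c F z

/-- The total derivative `D_i` with respect to `x^i`. -/
def totalX (i : Fin n) (F : Jet n N → ℝ) (z : Jet n N) : ℝ :=
  partialX i F z +
    ∑ᶠ c : JetIdx n N, z.2.2 (c.1, c.2.1, c.2.2 + Pi.single i 1) * partialU c F z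

/-- The iterated total derivative `D_1^{I_1} ⋯ D_n^{I_n}`. -/
def totalXs (I : Fin n → ℕ) (F : Jet n N → ℝ) : Jet n N → ℝ :=
  (List.finRange n).foldr (fun i G => (totalX i)^[I i] G) F

/-- The `ρ`-component `∑_I (∂F/∂u^ρ_I) D_I` of the linearization operator of `F`.
Each distinct `x`-derivative of `u^ρ` is counted once. -/
def lin (F : Jet n N → ℝ) (ρ : Fin N) (V : Jet n N → ℝ) (z : Jet n N) : ℝ :=
  ∑ᶠ I : Fin n → ℕ, partialU (ρ, 0, I) F z * totalXs I V z

/-- The formal adjoint `W ↦ ∑_I (-1)^|I| D_I ((∂F/∂u^ρ_I) W)` of `lin F ρ`. -/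
def adlin (F : Jet n N → ℝ) (ρ : Fin N) (W : Jet n N → ℝ) (z : Jet n N) : ℝ :=
  ∑ᶠ I : Fin n → ℕ, (-1) ^ order I * totalXs I (fun y => partialU (ρ, 0, I) F y * W y) z

/-- The restricted Euler operator `∑_I (-1)^|I| D_I ∂/∂u^σ_I` (only `x`-derivatives). -/
def euler (σ : Fin N) (P : Jet n N → ℝ) (z : Jet n N) : ℝ :=
  ∑ᶠ I : Fin n → ℕ, (-1) ^ order I * totalXs I (partialU (σ, 0, I) P) z

/-- The total `t`-derivative on the solution space of `u^σ_t + g^σ = 0`, for functions of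
`t`, `x` and `x`-derivatives of `u`: the coordinate `∂_t u^ρ_I` is replaced by `-D_I g^ρ`. -/
def solT (g : Fin N → Jet n N → ℝ) (F : Jet n N → ℝ) (z : Jet n N) : ℝ :=
  partialT F z -
    ∑ ρ, ∑ᶠ I : Fin n → ℕ, totalXs I (g ρ) z * partialU (ρ, 0, I) F z

/-! ### Multipliers, adjoint symmetries, variational expressions -/

/-- `Λ` is a set of multipliers for the system `u^σ_t + g^σ = 0`: on `U`, that is off the
solution space, `∑_σ (u^σ_t + g^σ) Λ_σ` is a total divergence `D_t Φ^t + ∑_i D_i Φ^i`. -/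
def IsMultiplier (U : Set (Jet n N)) (g Λ : Fin N → Jet n N → ℝ) : Prop :=
  ∃ (Φt : Jet n N → ℝ) (Φ : Fin n → Jet n N → ℝ),
    IsDiffFun U Φt ∧ (∀ i, IsDiffFun U (Φ i)) ∧
    ∀ z ∈ U, ∑ σ, (z.2.2 (σ, 1, 0) + g σ z) * Λ σ z = totalT Φt z + ∑ i, totalX i (Φ i) z

/-- `Λ` is an adjoint symmetry: the adjoint of the linearized system holds for `Λ` on the
solution space. -/
def IsAdjointSymmetry (U : Set (Jet n N)) (g Λ : Fin N → Jet n N → ℝ) : Prop :=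
  ∀ σ, ∀ z ∈ U, -solT g (Λ σ) z + ∑ ρ, adlin (g ρ) σ (Λ ρ) z = 0

/-- `Λ` is variational: it is the Euler-Lagrange expression of some function of `t`, `x`, `u`
and finitely many `x`-derivatives of `u`. -/
def IsVariational (U : Set (Jet n N)) (Λ : Fin N → Jet n N → ℝ) : Prop :=
  ∃ (k : ℕ) (P : Jet n N → ℝ), IsSpatialDiffFun U k P ∧ ∀ σ, ∀ z ∈ U, Λ σ z = euler σ P z

/-- The linearization operator of `Λ` is formally self-adjoint: for all `σ`, `ρ`, the operator
`∑_I (∂Λ_σ/∂u^ρ_I) D_I` equals `V ↦ ∑_I (-1)^|I| D_I ((∂Λ_ρ/∂u^σ_I) V)`. -/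
def HasSelfAdjointLin (U : Set (Jet n N)) (Λ : Fin N → Jet n N → ℝ) : Prop :=
  ∀ σ ρ, ∀ V, IsDiffFun U V → ∀ z ∈ U, lin (Λ σ) ρ V z = adlin (Λ ρ) σ V z

/-- The extra determining equations for expressions of order at most `p`, one for each
`σ`, `ρ` and each multi-index `I` of order `q ≤ p`. In terms of multi-indices the binomial
coefficient of the `r`-th order terms becomes `∏_i (K_i choose I_i)` with `K = I + J`,
`|K| = r`. -/
def ExtraDetEqs (U : Set (Jet n N)) (p : ℕ) (Λ : Fin N → Jet n N → ℝ) : Prop :=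
  ∀ (σ ρ : Fin N) (I : Fin n → ℕ), order I ≤ p → ∀ z ∈ U,
    (-1) ^ (order I + 1) * partialU (ρ, 0, I) (Λ σ) z +
      ∑ᶠ J : Fin n → ℕ, (-1) ^ order J * (∏ i, ((I i + J i).choose (I i) : ℝ)) *
        totalXs J (partialU (σ, 0, I + J) (Λ ρ)) z = 0

/-! ### Domains in jet space -/

/-- `∂v/∂t` for a function `v(t, x)`. -/
def derivT (v : ℝ × (Fin n → ℝ) → ℝ) (a : ℝ × (Fin n → ℝ)) : ℝ :=
  deriv (fun s => v (s, a.2)) a.1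

/-- `∂v/∂x^i` for a function `v(t, x)`. -/
def derivX (i : Fin n) (v : ℝ × (Fin n → ℝ) → ℝ) (a : ℝ × (Fin n → ℝ)) : ℝ :=
  deriv (fun s => v (a.1, Function.update a.2 i s)) (a.2 i)

/-- The derivative coordinates of the jet at `a = (t, x)` of a function `v(t, x)`. -/
def jetOf (v : Fin N → ℝ × (Fin n → ℝ) → ℝ) (a : ℝ × (Fin n → ℝ)) : JetIdx n N → ℝ :=
  fun c => derivT^[c.2.1] ((List.finRange n).foldr (fun i w => (derivX i)^[c.2.2 i] w) (v c.1)) a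

/-- The points `(t, x)` over which `U` lies. -/
def base (U : Set (Jet n N)) : Set (ℝ × (Fin n → ℝ)) := (fun z => (z.1, z.2.1)) '' U

/-- The domains on which the expressions are considered: open sets in jet space, star-shaped
over a base which is itself star-shaped, the centre of each fibre being the jet of a fixed
function `v(t, x)`. The whole jet space is one, with `v = 0`; other functions `v` allow for
expressions that are singular at some values of `u` or of its derivatives, for
instance at `u = 0`. -/
def IsStarDomain (U : Set (Jet n N)) : Prop :=
  IsOpen U ∧
  (∃ c ∈ base U, StarConvex ℝ c (base U)) ∧
  ∃ v : Fin N → ℝ × (Fin n → ℝ) → ℝ, (∀ σ, ContDiffOn ℝ ∞ (v σ) (base U)) ∧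
    ∀ a ∈ base U, StarConvex ℝ (jetOf v a) {y : JetIdx n N → ℝ | (a.1, a.2, y) ∈ U}

end CauchyKovalevskaya

end

open CauchyKovalevskaya

open scoped ContDiff

noncomputable section

namespace CauchyKovalevskaya

variable {n N : ℕ}

/-! ### Smooth dependence of integrals over `[0, 1]` on parameters -/

section ParametricIntegral

open Set Topology intervalIntegral

/-! The argument is algebra in `DiffAlg U`, the smooth functions of finitely many jet coordinates on
`U`. Total derivatives are commuting derivations of it, and a scalar differential operator is a
finitely supported family of coefficients. All four properties of `Λ` are compared with one identity
between coefficients, `gradAt ρ (Λ σ) = adjCoef (gradAt σ (Λ ρ))`: the linearization of `Λ` equals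
its adjoint.

Multipliers. Put G^ρ = u^ρ_t + g^ρ and let E_σ be the full Euler operator, with t-derivatives. The
product rule for E_σ and the splitting D_t f = 𝒟_t f + ∑_ρ (L_f)_ρ G^ρ (`D_none_eq`) give
`Eul_sum_mul`: E_σ(∑ G^ρ Λ_ρ) = (-𝒟_t Λ_σ + ∑ (L*_{g^ρ})_σ Λ_ρ) + ∑_ρ ((L*_{Λ_ρ})_σ - (L_{Λ_σ})_ρ)
G^ρ. The first bracket and the coefficients of the operators in the last sum are free of
t-derivatives of u, while G^τ contains u^τ_t. Differentiation with respect to ∂_t ∂_x^I u^τ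
therefore isolates each coefficient, and the left side vanishes for all σ exactly when `Λ` is an
adjoint symmetry with self-adjoint linearization (`Eul_sum_mul_eq_zero_iff`).

Divergences are the kernel of E. One inclusion is `Eul_divergence`. The other,
`mem_range_divergence_of_Eul_eq_zero`, contracts each fibre to the jet of v. As the centre is a jet,
the contraction is compatible with total derivatives (`D_homotopy`). So f minus its restriction to
the centre is ∑_ρ A_ρ(u^ρ - v^ρ) with operators A_ρ for which A_ρ*(1) is the homotopy integral of
E_ρ f, that is, zero; integration by parts leaves a divergence. The restriction to the centre is a
function of (t, x) on a star-shaped base, hence a divergence by a radial homotopy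
(`baseFn_mem_range_divergence`).

Variational expressions. Symmetry of second derivatives makes the linearization of an Euler-Lagrange
expression self-adjoint (`Op_gradAt_Eul`). Conversely P = ∑_ρ (u^ρ - v^ρ) ∫_0^1 Λ_ρ(h_s) ds, with
h_s the contraction, is a Lagrangian for a self-adjoint `Λ` (`Eul_lagrangian`).

Coefficients. The Leibniz rule puts the adjoint into normal form (`Op_adjCoef`), and an operator
vanishing on all differential functions has zero coefficients (`eq_zero_of_Op_eq_zero`). Hence
self-adjointness is the coefficient identity, which written out is the system of extra determining
equations (`extraDetEqs_iff`). -/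

theorem continuousOn_slice {E X : Type*} [TopologicalSpace E] [TopologicalSpace X]
    {G : ℝ × E → X} {W : Set (ℝ × E)} (hG : ContinuousOn G W) {x : E}
    (hx : ∀ s ∈ Icc (0 : ℝ) 1, (s, x) ∈ W) : ContinuousOn (fun s => G (s, x)) (Icc 0 1) :=
  hG.comp (by fun_prop) hx

theorem intervalIntegrable_slice {E F : Type*} [TopologicalSpace E] [NormedAddCommGroup F]
    {G : ℝ × E → F} {W : Set (ℝ × E)} (hG : ContinuousOn G W) {x : E}
    (hx : ∀ s ∈ Icc (0 : ℝ) 1, (s, x) ∈ W) :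
    IntervalIntegrable (fun s => G (s, x)) MeasureTheory.volume 0 1 := by
  apply ContinuousOn.intervalIntegrable
  rw [uIcc_of_le zero_le_one]
  exact continuousOn_slice hG hx

variable {E F : Type} [NormedAddCommGroup E] [NormedSpace ℝ E] [NormedAddCommGroup F]
  [NormedSpace ℝ F]

theorem contDiffOn_fderiv_comp_inr {G : ℝ × E → F} {W : Set (ℝ × E)} (hW : IsOpen W)
    (hG : ContDiffOn ℝ ∞ G W) :
    ContDiffOn ℝ ∞ (fun q => (fderiv ℝ G q).comp (ContinuousLinearMap.inr ℝ ℝ E)) W :=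
  (hG.fderiv_of_isOpen hW (m := ∞) (by simp)).clm_comp contDiffOn_const

/-- Differentiation under the integral sign over `[0, 1]` for a smooth integrand. -/
theorem hasFDerivAt_integral_slice [CompleteSpace F] {G : ℝ × E → F} {W : Set (ℝ × E)}
    (hW : IsOpen W) (hG : ContDiffOn ℝ ∞ G W) {x : E} (hx : ∀ s ∈ Icc (0 : ℝ) 1, (s, x) ∈ W) :
    HasFDerivAt (fun y => ∫ s in (0 : ℝ)..1, G (s, y))
      (∫ s in (0 : ℝ)..1, (fderiv ℝ G (s, x)).comp (ContinuousLinearMap.inr ℝ ℝ E)) x := by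
  set G' : ℝ × E → E →L[ℝ] F :=
    fun q => (fderiv ℝ G q).comp (ContinuousLinearMap.inr ℝ ℝ E) with hG'
  have hG'c : ContinuousOn G' W := (contDiffOn_fderiv_comp_inr hW hG).continuousOn
  obtain ⟨M, hM⟩ : ∃ M, ∀ s ∈ Icc (0 : ℝ) 1, ‖G' (s, x)‖ ≤ M :=
    isCompact_Icc.exists_bound_of_continuousOn (continuousOn_slice hG'c hx)
  have hV : IsOpen (W ∩ (fun q => ‖G' q‖) ⁻¹' Iio (M + 1)) :=
    hG'c.norm.isOpen_inter_preimage hW isOpen_Iio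
  -- The bound `M` on the compact slice over `x` persists, as `M + 1`, on a tube around it; this
  -- constant serves as the dominating function.
  obtain ⟨u, v, -, hv, hu', hv', huv⟩ := generalized_tube_lemma (isCompact_Icc (a := (0 : ℝ)) (b := 1))
    (isCompact_singleton (x := x)) hV (by
      rintro ⟨s, y⟩ ⟨hs, hy⟩
      obtain rfl : y = x := hy
      exact ⟨hx s hs, (hM s hs).trans_lt (lt_add_one M)⟩)
  have hvx : v ∈ 𝓝 x := hv.mem_nhds (hv' rfl)
  have hmem : ∀ s ∈ Icc (0 : ℝ) 1, ∀ y ∈ v, (s, y) ∈ W ∧ ‖G' (s, y)‖ < M + 1 :=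
    fun s hs y hy => huv ⟨hu' hs, hy⟩
  have hsub : uIoc (0 : ℝ) 1 ⊆ Icc 0 1 := by
    rw [uIoc_of_le zero_le_one]; exact Ioc_subset_Icc_self
  have hmeas : ∀ {X : Type} [NormedAddCommGroup X] {H : ℝ × E → X}, ContinuousOn H W →
      ∀ y ∈ v, MeasureTheory.AEStronglyMeasurable (fun s => H (s, y))
        (MeasureTheory.volume.restrict (uIoc (0 : ℝ) 1)) := fun hH y hy =>
    ((continuousOn_slice hH fun s hs => (hmem s hs y hy).1).mono hsub).aestronglyMeasurable
      measurableSet_uIoc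
  refine hasFDerivAt_integral_of_dominated_of_fderiv_le (F := fun y s => G (s, y))
    (F' := fun y s => G' (s, y)) (bound := fun _ => M + 1) hvx ?_ ?_ ?_ ?_ ?_ ?_
  · filter_upwards [hvx] with y hy using hmeas hG.continuousOn y hy
  · exact intervalIntegrable_slice hG.continuousOn hx
  · exact hmeas hG'c x (hv' rfl)
  · exact .of_forall fun s hs y hy => (hmem s (hsub hs) y hy).2.le
  · simp
  · refine .of_forall fun s hs y hy => ?_
    have h1 : HasFDerivAt G (fderiv ℝ G (s, y)) (s, y) :=
      ((hG.contDiffAt (hW.mem_nhds (hmem s (hsub hs) y hy).1)).differentiableAt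
        (by simp)).hasFDerivAt
    have h2 : HasFDerivAt (fun y : E => (s, y)) (ContinuousLinearMap.inr ℝ ℝ E) y :=
      hasFDerivAt_prodMk_right s y
    exact h1.comp y h2

/-- Induction on the order of smoothness: the derivative is an integral of the same kind with values
in `E →L[ℝ] F`, so the target space has to vary. -/
theorem contDiffOn_integral_slice [CompleteSpace F] {G : ℝ × E → F} {W : Set (ℝ × E)}
    {Ω : Set E} (hW : IsOpen W) (hΩ : IsOpen Ω) (hG : ContDiffOn ℝ ∞ G W)
    (hx : ∀ x ∈ Ω, ∀ s ∈ Icc (0 : ℝ) 1, (s, x) ∈ W) :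
    ContDiffOn ℝ ∞ (fun y => ∫ s in (0 : ℝ)..1, G (s, y)) Ω := by
  rw [contDiffOn_infty]
  intro k
  induction k generalizing F with
  | zero =>
    rw [Nat.cast_zero, contDiffOn_zero]
    exact fun x h => (hasFDerivAt_integral_slice hW hG (hx x h)).continuousAt.continuousWithinAt
  | succ k ih =>
    rw [Nat.cast_succ, contDiffOn_succ_iff_fderiv_of_isOpen hΩ]
    refine ⟨fun x h => (hasFDerivAt_integral_slice hW hG
      (hx x h)).differentiableAt.differentiableWithinAt, by simp, ?_⟩
    exact (ih (contDiffOn_fderiv_comp_inr hW hG)).congr fun x h =>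
      (hasFDerivAt_integral_slice hW hG (hx x h)).fderiv

end ParametricIntegral

/-! ### The algebra of differential functions and vector fields on jet space -/

section DiffAlg

open Topology TopologicalSpace

/-- Truncation of jets as a continuous linear map. -/
def truncL (S : Finset (JetIdx n N)) : Jet n N →L[ℝ] ℝ × (Fin n → ℝ) × (S → ℝ) :=
  (ContinuousLinearMap.fst ℝ _ _).prod
    (((ContinuousLinearMap.fst ℝ _ _).comp (ContinuousLinearMap.snd ℝ _ _)).prod
      (ContinuousLinearMap.pi fun c : S => (ContinuousLinearMap.proj (c : JetIdx n N)).comp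
        ((ContinuousLinearMap.snd ℝ _ _).comp (ContinuousLinearMap.snd ℝ _ _))))

theorem truncL_apply (S : Finset (JetIdx n N)) (z : Jet n N) : truncL S z = trunc S z := rfl

theorem trunc_add_smul (S : Finset (JetIdx n N)) (z v : Jet n N) (s : ℝ) :
    trunc S (z + s • v) = trunc S z + s • trunc S v := by
  simp only [← truncL_apply, map_add, map_smul]

/-- There is a continuous section through any jet `z`: overwrite the coordinates in `S` and keep the
others from `z`. It follows that `trunc S '' U` is open, so smoothness on it concerns genuine
derivatives. -/
theorem isOpenMap_trunc (S : Finset (JetIdx n N)) : IsOpenMap (trunc S) := by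
  classical
  refine IsOpenMap.of_sections fun z =>
    ⟨fun y => (y.1, y.2.1, fun c => if h : c ∈ S then y.2.2 ⟨c, h⟩ else z.2.2 c), ?_, ?_, ?_⟩
  · refine Continuous.continuousAt ?_
    refine continuous_fst.prodMk ((continuous_fst.comp continuous_snd).prodMk
      (continuous_pi fun c => ?_))
    by_cases h : c ∈ S
    · simp only [h, dite_true]; fun_prop
    · simp only [h, dite_false]; fun_prop
  · simp [trunc]
  · intro y
    ext <;> simp [trunc]

/-- The base of an open subset of jet space is open. -/
theorem isOpen_base {U : Set (Jet n N)} (hU : IsOpen U) : IsOpen (base U) := by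
  have h : base U = (fun y : ℝ × (Fin n → ℝ) × ((∅ : Finset (JetIdx n N)) → ℝ) =>
      (y.1, y.2.1)) '' (trunc ∅ '' U) := by
    rw [Set.image_image]; rfl
  rw [h]
  have h2 : IsOpenMap (fun y : ℝ × (Fin n → ℝ) × ((∅ : Finset (JetIdx n N)) → ℝ) =>
      (y.1, y.2.1)) := IsOpenMap.id.prodMap isOpenMap_fst
  exact h2 _ (isOpenMap_trunc _ _ hU)

variable {U : Opens (Jet n N)}

/-- `φ` represents `f` as a smooth function of `t`, `x` and the derivatives in `S`. -/
def IsRep (U : Opens (Jet n N)) (S : Finset (JetIdx n N))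
    (φ : ℝ × (Fin n → ℝ) × (S → ℝ) → ℝ) (f : U → ℝ) : Prop :=
  ContDiffOn ℝ ∞ φ (trunc S '' U) ∧ ∀ z : U, f z = φ (trunc S z)

theorem IsRep.mono {S S' : Finset (JetIdx n N)} (h : S ⊆ S')
    {φ : ℝ × (Fin n → ℝ) × (S → ℝ) → ℝ} {f : U → ℝ} (hf : IsRep U S φ f) :
    IsRep U S' (fun y => φ (y.1, y.2.1, fun c => y.2.2 ⟨c, h c.2⟩)) f := by
  refine ⟨hf.1.comp (ContDiff.contDiffOn (by fun_prop)) ?_, fun z => hf.2 z⟩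
  rintro _ ⟨z, hz, rfl⟩
  exact ⟨z, hz, rfl⟩

theorem IsRep.contDiffAt {S : Finset (JetIdx n N)} {φ : ℝ × (Fin n → ℝ) × (S → ℝ) → ℝ}
    {f : U → ℝ} (hf : IsRep U S φ f) (z : U) : ContDiffAt ℝ ∞ φ (trunc S z) :=
  hf.1.contDiffAt ((isOpenMap_trunc S _ U.2).mem_nhds ⟨z, z.2, rfl⟩)

/-- The differential functions on `U`, as a subalgebra. -/
def diffSubalgebra (U : Opens (Jet n N)) : Subalgebra ℝ (U → ℝ) where
  carrier := {f | ∃ S φ, IsRep U S φ f}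
  mul_mem' := by
    classical
    rintro f g ⟨S, φ, hf⟩ ⟨S', ψ, hg⟩
    have hf' := hf.mono (Finset.subset_union_left (s₂ := S'))
    have hg' := hg.mono (Finset.subset_union_right (s₁ := S))
    exact ⟨_, _, hf'.1.mul hg'.1, fun z => congrArg₂ (· * ·) (hf'.2 z) (hg'.2 z)⟩
  add_mem' := by
    classical
    rintro f g ⟨S, φ, hf⟩ ⟨S', ψ, hg⟩
    have hf' := hf.mono (Finset.subset_union_left (s₂ := S'))
    have hg' := hg.mono (Finset.subset_union_right (s₁ := S))
    exact ⟨_, _, hf'.1.add hg'.1, fun z => congrArg₂ (· + ·) (hf'.2 z) (hg'.2 z)⟩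
  algebraMap_mem' r := ⟨∅, fun _ => r, contDiffOn_const, fun _ => rfl⟩

/-- The algebra of differential functions on `U`. -/
def DiffAlg (U : Opens (Jet n N)) : Type := diffSubalgebra U

instance : CommRing (DiffAlg U) := inferInstanceAs (CommRing (diffSubalgebra U))

instance : Algebra ℝ (DiffAlg U) := inferInstanceAs (Algebra ℝ (diffSubalgebra U))

/-- The function underlying an element of the algebra of differential functions. -/
def DiffAlg.toFun (f : DiffAlg U) : U → ℝ := Subtype.val f

instance : CoeOut (DiffAlg U) (U → ℝ) := ⟨DiffAlg.toFun⟩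

@[ext]
theorem DiffAlg.ext {f g : DiffAlg U} (h : ∀ z, (f : U → ℝ) z = (g : U → ℝ) z) : f = g :=
  Subtype.ext (funext h)

@[simp]
theorem DiffAlg.coe_add (f g : DiffAlg U) : ((f + g : DiffAlg U) : U → ℝ) = (f : U → ℝ) + g := rfl

@[simp]
theorem DiffAlg.coe_mul (f g : DiffAlg U) : ((f * g : DiffAlg U) : U → ℝ) = (f : U → ℝ) * g := rfl

@[simp]
theorem DiffAlg.coe_smul (r : ℝ) (f : DiffAlg U) :
    ((r • f : DiffAlg U) : U → ℝ) = r • (f : U → ℝ) := rfl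

@[simp]
theorem DiffAlg.coe_zero : ((0 : DiffAlg U) : U → ℝ) = 0 := rfl

theorem exists_isRep (f : DiffAlg U) : ∃ S φ, IsRep U S φ f := f.2

open Classical in
/-- Extension by zero. -/
def extZ (f : U → ℝ) (z : Jet n N) : ℝ := if h : z ∈ U then f ⟨z, h⟩ else 0

theorem extZ_of_mem (f : U → ℝ) (z : U) : extZ f z = f z := by
  simp [extZ]

theorem eventually_line_mem (z : U) (v : Jet n N) : ∀ᶠ s : ℝ in 𝓝 0, (z : Jet n N) + s • v ∈ U := by
  have h : ContinuousAt (fun s : ℝ => (z : Jet n N) + s • v) 0 := by fun_prop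
  exact h.eventually_mem (by simpa using U.2.mem_nhds z.2)

/-- The derivative of `f` at `z` along `v`. -/
def dirDeriv (f : U → ℝ) (z : U) (v : Jet n N) : ℝ :=
  deriv (fun s : ℝ => extZ f (z + s • v)) 0

/-- Calculus on the jet space, which carries only a product topology, is reduced to the Fréchet
derivative of a representative in finitely many variables. -/
theorem IsRep.hasDerivAt_line {S : Finset (JetIdx n N)} {φ : ℝ × (Fin n → ℝ) × (S → ℝ) → ℝ}
    {f : U → ℝ} (hf : IsRep U S φ f) (z : U) (v : Jet n N) :
    HasDerivAt (fun s : ℝ => extZ f (z + s • v)) (fderiv ℝ φ (trunc S z) (trunc S v)) 0 := by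
  have h1 : HasFDerivAt φ (fderiv ℝ φ (trunc S z)) (trunc S z + (0 : ℝ) • trunc S v) := by
    rw [zero_smul, add_zero]
    exact ((hf.contDiffAt z).differentiableAt (by simp)).hasFDerivAt
  have h2 : HasDerivAt (fun s : ℝ => trunc S z + s • trunc S v) (trunc S v) 0 := by
    simpa using ((hasDerivAt_id (0 : ℝ)).smul_const (trunc S v)).const_add (trunc S z)
  refine (h1.comp_hasDerivAt 0 h2).congr_of_eventuallyEq ?_
  filter_upwards [eventually_line_mem z v] with s hs
  rw [extZ_of_mem f ⟨_, hs⟩, hf.2 ⟨_, hs⟩, Function.comp, trunc_add_smul]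

theorem IsRep.dirDeriv_eq {S : Finset (JetIdx n N)} {φ : ℝ × (Fin n → ℝ) × (S → ℝ) → ℝ}
    {f : U → ℝ} (hf : IsRep U S φ f) (z : U) (v : Jet n N) :
    dirDeriv f z v = fderiv ℝ φ (trunc S z) (trunc S v) := (hf.hasDerivAt_line z v).deriv

theorem IsRep.dirDeriv {S : Finset (JetIdx n N)} {φ : ℝ × (Fin n → ℝ) × (S → ℝ) → ℝ}
    {f : U → ℝ} (hf : IsRep U S φ f) (v : Jet n N) :
    IsRep U S (fun y => fderiv ℝ φ y (trunc S v)) (fun z => dirDeriv f z v) :=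
  ⟨(hf.1.fderiv_of_isOpen (isOpenMap_trunc S _ U.2) (m := ∞) (by simp)).clm_apply
    contDiffOn_const, fun z => hf.dirDeriv_eq z v⟩

theorem hasDerivAt_line (f : DiffAlg U) (z : U) (v : Jet n N) :
    HasDerivAt (fun s : ℝ => extZ (f : U → ℝ) (z + s • v)) (dirDeriv f z v) 0 := by
  obtain ⟨S, φ, hf⟩ := exists_isRep f
  rw [hf.dirDeriv_eq]
  exact hf.hasDerivAt_line z v

theorem dirDeriv_add_right (f : DiffAlg U) (z : U) (v w : Jet n N) :
    dirDeriv f z (v + w) = dirDeriv f z v + dirDeriv f z w := by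
  obtain ⟨S, φ, hf⟩ := exists_isRep f
  simp only [hf.dirDeriv_eq, ← truncL_apply, map_add]

theorem dirDeriv_smul_right (f : DiffAlg U) (z : U) (r : ℝ) (v : Jet n N) :
    dirDeriv f z (r • v) = r * dirDeriv f z v := by
  obtain ⟨S, φ, hf⟩ := exists_isRep f
  simp only [hf.dirDeriv_eq, ← truncL_apply, map_smul, smul_eq_mul]

/-- Differentiation in a constant direction, as a derivation. -/
def pd (v : Jet n N) : Derivation ℝ (DiffAlg U) (DiffAlg U) :=
  Derivation.mk'
    { toFun := fun f => ⟨fun z => dirDeriv f z v, by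
        obtain ⟨S, φ, hf⟩ := exists_isRep f
        exact ⟨S, _, hf.dirDeriv v⟩⟩
      map_add' := fun f g => by
        ext z
        refine HasDerivAt.deriv (((hasDerivAt_line f z v).add
          (hasDerivAt_line g z v)).congr_of_eventuallyEq (.of_forall fun s => ?_))
        by_cases h : (z : Jet n N) + s • v ∈ U <;> simp [extZ, h]
      map_smul' := fun r f => by
        ext z
        refine HasDerivAt.deriv (((hasDerivAt_line f z v).const_mul r).congr_of_eventuallyEq
          (.of_forall fun s => ?_))
        by_cases h : (z : Jet n N) + s • v ∈ U <;> simp [extZ, h] }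
    (fun f g => by
      ext z
      refine (HasDerivAt.deriv (((hasDerivAt_line f z v).mul
          (hasDerivAt_line g z v)).congr_of_eventuallyEq (.of_forall fun s => ?_))).trans ?_
      · by_cases h : (z : Jet n N) + s • v ∈ U <;> simp [extZ, h]
      · change _ = (f : U → ℝ) z * dirDeriv g z v + (g : U → ℝ) z * dirDeriv f z v
        rw [zero_smul, add_zero, extZ_of_mem, extZ_of_mem]
        ring)

theorem pd_apply (v : Jet n N) (f : DiffAlg U) (z : U) : (pd v f : U → ℝ) z = dirDeriv f z v :=
  rfl

theorem pd_add (v w : Jet n N) (f : DiffAlg U) : pd (v + w) f = pd v f + pd w f := by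
  ext z; exact dirDeriv_add_right f z v w

/-- Both sides are values of the second Fréchet derivative of one representative, which is
symmetric. -/
theorem pd_comm (v w : Jet n N) (f : DiffAlg U) : pd v (pd w f) = pd w (pd v f) := by
  obtain ⟨S, φ, hf⟩ := exists_isRep f
  ext z
  have key : ∀ v w : Jet n N, (pd v (pd w f) : U → ℝ) z
      = fderiv ℝ (fderiv ℝ φ) (trunc S z) (trunc S v) (trunc S w) := fun v w => by
    refine ((hf.dirDeriv w).dirDeriv_eq z v).trans ?_
    have h : DifferentiableAt ℝ (fderiv ℝ φ) (trunc S z) :=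
      ((hf.contDiffAt z).fderiv_right (m := ∞) (by simp)).differentiableAt (by simp)
    rw [fderiv_clm_apply h (differentiableAt_const _)]
    simp
  rw [key, key]
  exact ((hf.contDiffAt z).isSymmSndFDerivAt (by
    rw [minSmoothness_of_isRCLikeNormedField]
    exact WithTop.coe_le_coe.2 (le_top : (2 : ℕ∞) ≤ ⊤))).eq _ _

/-- The direction of the derivative coordinate `c`. -/
def dirU (c : JetIdx n N) : Jet n N := (0, 0, Pi.single c 1)

/-- A direction in the space of independent variables, as a direction in jet space. -/
def dirB (b : ℝ × (Fin n → ℝ)) : Jet n N := (b.1, b.2, 0)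

theorem IsRep.pd_dirU_eq_zero {S : Finset (JetIdx n N)} {φ : ℝ × (Fin n → ℝ) × (S → ℝ) → ℝ}
    {f : DiffAlg U} (hf : IsRep U S φ f) {c : JetIdx n N} (hc : c ∉ S) : pd (dirU c) f = 0 := by
  ext z
  rw [pd_apply, hf.dirDeriv_eq]
  have : trunc S (dirU c) = 0 := by
    ext d
    · rfl
    · rfl
    · have : (d : JetIdx n N) ≠ c := fun h => hc (h ▸ d.2)
      simp [trunc, dirU, Pi.single_apply, this]
  simp [this]

theorem finite_pd_ne_zero (f : DiffAlg U) : (Function.support fun c => pd (dirU c) f).Finite := by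
  obtain ⟨S, φ, hf⟩ := exists_isRep f
  refine S.finite_toSet.subset fun c hc => ?_
  by_contra h
  exact hc (hf.pd_dirU_eq_zero h)

/-- The partial derivatives with respect to the derivative coordinates. -/
def grad : Derivation ℝ (DiffAlg U) (JetIdx n N →₀ DiffAlg U) :=
  Derivation.mk'
    { toFun := fun f => Finsupp.ofSupportFinite _ (finite_pd_ne_zero f)
      map_add' := fun f g => by ext1 c; exact map_add (pd (dirU c)) f g
      map_smul' := fun r f => by ext1 c; exact (pd (dirU c)).map_smul r f }
    (fun f g => by ext1 c; exact (pd (dirU c)).leibniz f g)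

theorem grad_apply (f : DiffAlg U) (c : JetIdx n N) : grad f c = pd (dirU c) f := rfl

theorem IsRep.grad_support_subset {S : Finset (JetIdx n N)}
    {φ : ℝ × (Fin n → ℝ) × (S → ℝ) → ℝ} {f : DiffAlg U} (hf : IsRep U S φ f) :
    (grad f).support ⊆ S := fun c hc => by
  by_contra h
  exact (Finsupp.mem_support_iff.1 hc) (hf.pd_dirU_eq_zero h)

/-- The derivation `∂_b + ∑_c a_c ∂/∂u_c`. -/
def vf (b : ℝ × (Fin n → ℝ)) (a : JetIdx n N → DiffAlg U) :
    Derivation ℝ (DiffAlg U) (DiffAlg U) :=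
  pd (dirB b) + (Finsupp.linearCombination (DiffAlg U) a).compDer grad

theorem vf_apply (b : ℝ × (Fin n → ℝ)) (a : JetIdx n N → DiffAlg U) (f : DiffAlg U) :
    vf b a f = pd (dirB b) f + Finsupp.linearCombination (DiffAlg U) a (grad f) := rfl

theorem linearCombination_eq_sum {g : JetIdx n N →₀ DiffAlg U} {S : Finset (JetIdx n N)}
    (hS : g.support ⊆ S) (a : JetIdx n N → DiffAlg U) :
    Finsupp.linearCombination (DiffAlg U) a g = ∑ c ∈ S, g c * a c := by
  rw [Finsupp.linearCombination_apply]
  exact Finsupp.sum_of_support_subset _ hS _ (by simp)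

theorem vf_eq_sum {f : DiffAlg U} {S : Finset (JetIdx n N)} (hS : (grad f).support ⊆ S)
    (b : ℝ × (Fin n → ℝ)) (a : JetIdx n N → DiffAlg U) :
    vf b a f = pd (dirB b) f + ∑ c ∈ S, pd (dirU c) f * a c := by
  rw [vf_apply, linearCombination_eq_sum hS]; rfl

/-- Partial derivatives commute, so differentiating brings in no new coordinate. All sums in the
commutator formula can thus run over the support of `grad f`. -/
theorem grad_pd_support_subset (v : Jet n N) (f : DiffAlg U) :
    (grad (pd v f)).support ⊆ (grad f).support := fun c hc => by
  rw [Finsupp.mem_support_iff, grad_apply, pd_comm] at hc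
  rw [Finsupp.mem_support_iff, grad_apply]
  exact fun h => hc (by rw [h, map_zero])

/-- The commutator of two vector fields on jet space. -/
theorem vf_vf_sub (b b' : ℝ × (Fin n → ℝ)) (a a' : JetIdx n N → DiffAlg U) (f : DiffAlg U) :
    vf b a (vf b' a' f) - vf b' a' (vf b a f)
      = Finsupp.linearCombination (DiffAlg U) (fun c => vf b a (a' c) - vf b' a' (a c))
          (grad f) := by
  -- The terms with second derivatives of `f` are symmetric in the two fields, by `h1` and `h2`
  -- below, and cancel; only the derivatives of the coefficients survive.
  have expand : ∀ (b b' : ℝ × (Fin n → ℝ)) (a a' : JetIdx n N → DiffAlg U),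
      vf b a (vf b' a' f) = (pd (dirB b) (pd (dirB b') f)
        + ∑ d ∈ (grad f).support, pd (dirU d) (pd (dirB b') f) * a d)
        + ∑ c ∈ (grad f).support, (pd (dirU c) f * vf b a (a' c)
          + a' c * (pd (dirB b) (pd (dirU c) f)
            + ∑ d ∈ (grad f).support, pd (dirU d) (pd (dirU c) f) * a d)) := by
    intro b b' a a'
    rw [vf_eq_sum (S := (grad f).support) subset_rfl b' a', map_add, map_sum,
      vf_eq_sum (grad_pd_support_subset _ f)]
    congr 1
    refine Finset.sum_congr rfl fun c _ => ?_
    rw [Derivation.leibniz, smul_eq_mul, smul_eq_mul,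
      vf_eq_sum (f := pd (dirU c) f) (grad_pd_support_subset _ f)]
  rw [expand, expand, linearCombination_eq_sum subset_rfl]
  simp only [mul_add, mul_sub, Finset.sum_add_distrib, Finset.sum_sub_distrib, grad_apply,
    Finset.mul_sum]
  rw [pd_comm (dirB b') (dirB b)]
  have h1 : ∑ c ∈ (grad f).support, ∑ d ∈ (grad f).support,
      a c * (pd (dirU d) (pd (dirU c) f) * a' d)
      = ∑ c ∈ (grad f).support, ∑ d ∈ (grad f).support,
      a' c * (pd (dirU d) (pd (dirU c) f) * a d) := by
    rw [Finset.sum_comm]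
    refine Finset.sum_congr rfl fun c _ => Finset.sum_congr rfl fun d _ => ?_
    rw [pd_comm]; ring
  have h2 : ∀ (b : ℝ × (Fin n → ℝ)) (a : JetIdx n N → DiffAlg U),
      ∑ c ∈ (grad f).support, pd (dirU c) (pd (dirB b) f) * a c
      = ∑ c ∈ (grad f).support, a c * pd (dirB b) (pd (dirU c) f) := fun b a =>
    Finset.sum_congr rfl fun c _ => by rw [pd_comm]; ring
  rw [h1, h2, h2]
  ring

end DiffAlg

/-! ### Total derivatives and their iterates -/

section TotalDerivatives

open Topology TopologicalSpace

variable {U : Opens (Jet n N)}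

/-- Multi-indices of derivatives with respect to `t` and `x`. -/
abbrev MIdx (n : ℕ) : Type := ℕ × (Fin n → ℕ)

/-- The coordinate function `u_c`. -/
def coordU (c : JetIdx n N) : DiffAlg U :=
  ⟨fun z => z.1.2.2 c, {c}, fun y => y.2.2 ⟨c, Finset.mem_singleton_self c⟩,
    ContDiff.contDiffOn (by fun_prop), fun _ => rfl⟩

theorem pd_coordU (v : Jet n N) (c : JetIdx n N) :
    pd v (coordU c : DiffAlg U) = algebraMap ℝ _ (v.2.2 c) := by
  ext z
  have h : HasDerivAt (fun s : ℝ => z.1.2.2 c + s * v.2.2 c) (v.2.2 c) 0 := by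
    simpa using ((hasDerivAt_id (0 : ℝ)).mul_const (v.2.2 c)).const_add (z.1.2.2 c)
  refine HasDerivAt.deriv (h.congr_of_eventuallyEq ?_)
  filter_upwards [eventually_line_mem z v] with s hs
  rw [extZ_of_mem _ ⟨_, hs⟩]
  rfl

theorem pd_dirU_coordU (c d : JetIdx n N) :
    pd (dirU d) (coordU c : DiffAlg U) = if c = d then 1 else 0 := by
  rw [pd_coordU]
  by_cases h : c = d
  · subst h; simp [dirU]
  · simp [dirU, h]

theorem pd_dirB_coordU (b : ℝ × (Fin n → ℝ)) (c : JetIdx n N) :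
    pd (dirB b) (coordU c : DiffAlg U) = 0 := by
  rw [pd_coordU]; simp [dirB]

theorem grad_coordU (c : JetIdx n N) : grad (coordU c : DiffAlg U) = Finsupp.single c 1 := by
  ext1 d
  rw [grad_apply, pd_dirU_coordU, Finsupp.single_apply]

theorem vf_coordU (b : ℝ × (Fin n → ℝ)) (a : JetIdx n N → DiffAlg U) (c : JetIdx n N) :
    vf b a (coordU c) = a c := by
  rw [vf_apply, pd_dirB_coordU, grad_coordU, Finsupp.linearCombination_single, zero_add, one_smul]

theorem dirB_zero : (dirB 0 : Jet n N) = 0 := rfl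

theorem pd_zero (f : DiffAlg U) : pd 0 f = 0 := by
  have h := pd_add 0 0 f
  rwa [add_zero, left_eq_add] at h

/-- As a vector field with constant coefficients, ∂/∂u_d falls under the commutator formula
`vf_vf_sub`. -/
theorem pd_dirU_eq_vf (d : JetIdx n N) (f : DiffAlg U) :
    pd (dirU d) f = vf 0 (fun c => if c = d then 1 else 0) f := by
  rw [vf_apply, dirB_zero, pd_zero, zero_add, Finsupp.linearCombination_apply, Finsupp.sum]
  simp only [smul_eq_mul, mul_ite, mul_one, mul_zero, Finset.sum_ite_eq', Finsupp.mem_support_iff]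
  split_ifs with h
  · rfl
  · exact Finsupp.notMem_support_iff.1 h

/-- The coordinate direction of an independent variable; `none` stands for `t`. -/
def indepDir : Option (Fin n) → ℝ × (Fin n → ℝ)
  | none => (1, 0)
  | some i => (0, Pi.single i 1)

/-- The multi-index of a first derivative; `none` stands for `t`. -/
def unitIdx : Option (Fin n) → MIdx n
  | none => (1, 0)
  | some i => (0, Pi.single i 1)

/-- The index of the derivative of `u_c` with respect to an independent variable. -/
def shift (i : Option (Fin n)) (c : JetIdx n N) : JetIdx n N := (c.1, c.2 + unitIdx i)

theorem shift_comm (i j : Option (Fin n)) (c : JetIdx n N) :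
    shift i (shift j c) = shift j (shift i c) := by
  simp only [shift, add_assoc, add_comm (unitIdx i)]

/-- The total derivative with respect to an independent variable. -/
def D (i : Option (Fin n)) : Derivation ℝ (DiffAlg U) (DiffAlg U) :=
  vf (indepDir i) (fun c => coordU (shift i c))

theorem D_coordU (i : Option (Fin n)) (c : JetIdx n N) :
    D i (coordU c : DiffAlg U) = coordU (shift i c) := vf_coordU _ _ _

/-- The commutator has coefficients D_i u_{c+j} - D_j u_{c+i}, and these vanish. -/
theorem D_comm (i j : Option (Fin n)) (f : DiffAlg U) : D i (D j f) = D j (D i f) := by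
  rw [← sub_eq_zero, D, D, vf_vf_sub]
  simp only [vf_coordU, shift_comm i j, sub_self]
  exact LinearMap.congr_fun (Finsupp.linearCombination_zero _ (DiffAlg U) (DiffAlg U)) _

/-- The commutator of the partial derivatives with a total derivative. -/
theorem grad_D (i : Option (Fin n)) (f : DiffAlg U) :
    grad (D i f) = (grad f).mapRange (D i) (map_zero _) + (grad f).mapDomain (shift i) := by
  ext1 d
  rw [Finsupp.add_apply, Finsupp.mapRange_apply, grad_apply, grad_apply, ← sub_eq_iff_eq_add',
    pd_dirU_eq_vf, pd_dirU_eq_vf, D, vf_vf_sub, Finsupp.mapDomain, Finsupp.sum_apply,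
    Finsupp.linearCombination_apply]
  refine Finsupp.sum_congr fun c _ => ?_
  -- The coefficient of ∂f/∂u_c in the commutator is ∂u_{c+i}/∂u_d, because D_i annihilates the
  -- constant coefficients of ∂/∂u_d.
  rw [← pd_dirU_eq_vf, pd_dirU_coordU, Finsupp.single_apply]
  by_cases h : c = d <;> by_cases h' : shift i c = d <;> simp [h, h', map_zero]

/-! ### Iterated total derivatives -/

/-- Total derivatives as linear maps. -/
def De (i : Option (Fin n)) : Module.End ℝ (DiffAlg U) := (D i).toLinearMap

theorem De_commute (i j : Option (Fin n)) : Commute (De i : Module.End ℝ (DiffAlg U)) (De j) :=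
  LinearMap.ext fun f => D_comm i j f

theorem De_pow_commute (i : Option (Fin n)) (k : ℕ) (I : Fin n → ℕ) :
    Commute (De i ^ k : Module.End ℝ (DiffAlg U))
      ((List.finRange n).map fun i => De (some i) ^ I i).prod := by
  refine Commute.list_prod_right _ _ fun y hy => ?_
  obtain ⟨j, -, rfl⟩ := List.mem_map.1 hy
  exact (De_commute _ _).pow_pow _ _

/-- The iterated total derivative. -/
def DD (q : MIdx n) : Module.End ℝ (DiffAlg U) :=
  De none ^ q.1 * ((List.finRange n).map fun i => De (some i) ^ q.2 i).prod

theorem list_prod_pow_add {M ι : Type*} [Monoid M] (x : ι → M) (hx : ∀ i j, Commute (x i) (x j))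
    (l : List ι) (I J : ι → ℕ) : (l.map fun i => x i ^ (I i + J i)).prod
      = (l.map fun i => x i ^ I i).prod * (l.map fun i => x i ^ J i).prod := by
  induction l with
  | nil => simp
  | cons i l ih =>
    have h : Commute (x i ^ J i) (l.map fun i => x i ^ I i).prod := by
      refine Commute.list_prod_right _ _ fun y hy => ?_
      obtain ⟨j, -, rfl⟩ := List.mem_map.1 hy
      exact (hx i j).pow_pow _ _
    rw [List.map_cons, List.map_cons, List.map_cons, List.prod_cons, List.prod_cons,
      List.prod_cons, ih, pow_add]
    simp only [mul_assoc]
    rw [← mul_assoc (x i ^ J i), h.eq, mul_assoc]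

theorem DD_zero : (DD 0 : Module.End ℝ (DiffAlg U)) = 1 := by
  have h : ∀ l : List (Fin n), (l.map fun _ => (1 : Module.End ℝ (DiffAlg U))).prod = 1 := by
    intro l; induction l <;> simp_all
  simp only [DD, Prod.fst_zero, Prod.snd_zero, Pi.zero_apply, pow_zero, h, mul_one]

theorem DD_add (q r : MIdx n) : (DD (q + r) : Module.End ℝ (DiffAlg U)) = DD q * DD r := by
  simp only [DD, Prod.fst_add, Prod.snd_add, Pi.add_apply]
  rw [list_prod_pow_add _ (fun i j => De_commute _ _), pow_add]
  simp only [mul_assoc]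
  rw [← mul_assoc (De (U := U) none ^ r.1), (De_pow_commute none r.1 q.2).eq, mul_assoc]

theorem DD_unitIdx (i : Option (Fin n)) : (DD (unitIdx i) : Module.End ℝ (DiffAlg U)) = De i := by
  cases i with
  | none =>
    have h := DD_zero (U := U)
    simp only [DD, Prod.fst_zero, pow_zero, one_mul] at h
    simp only [DD, unitIdx, pow_one]
    rw [show (0 : Fin n → ℕ) = (0 : MIdx n).2 from rfl, h, mul_one]
  | some i =>
    simp only [DD, unitIdx, pow_zero, one_mul]
    rw [List.prod_map_eq_pow_single i]
    · simp [List.count_eq_one_of_mem (List.nodup_finRange n) (List.mem_finRange i)]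
    · intro j hj _
      simp [hj]

theorem DD_unit_add (i : Option (Fin n)) (q : MIdx n) (f : DiffAlg U) :
    DD (unitIdx i + q) f = D i (DD q f) := by
  rw [DD_add, DD_unitIdx]; rfl

theorem DD_add_unit (i : Option (Fin n)) (q : MIdx n) (f : DiffAlg U) :
    DD (q + unitIdx i) f = D i (DD q f) := by
  rw [add_comm, DD_unit_add]

theorem DD_D (i : Option (Fin n)) (q : MIdx n) (f : DiffAlg U) :
    DD q (D i f) = D i (DD q f) := by
  rw [← DD_add_unit, DD_add, DD_unitIdx]; rfl

/-- Multi-indices are generated by the unit ones. The t-order is removed first, then the x-indices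
by induction on their total order; identities for `DD q` thereby reduce to one total derivative. -/
theorem MIdx.induction {p : MIdx n → Prop} (zero : p 0)
    (add : ∀ i q, p q → p (unitIdx i + q)) (q : MIdx n) : p q := by
  obtain ⟨k, I⟩ := q
  induction k with
  | zero =>
    induction h : order I generalizing I with
    | zero =>
      have : I = 0 := by
        funext i
        exact (Finset.sum_eq_zero_iff.1 h) i (Finset.mem_univ i)
      rw [this]; exact zero
    | succ m ih =>
      obtain ⟨i, hi⟩ : ∃ i, I i ≠ 0 := by
        by_contra! hI
        simp [order, hI] at h
      have hI : I = Pi.single i 1 + (I - Pi.single i 1) := by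
        funext j
        by_cases hj : j = i
        · subst hj; simp; omega
        · simp [hj]
      have := add (some i) _ (ih (I - Pi.single i 1) (by
        rw [hI] at h
        simp only [order, Pi.add_apply, Finset.sum_add_distrib, Finset.sum_pi_single',
          Finset.mem_univ, if_true] at h
        simp only [order]; omega))
      rw [hI, show ((0, Pi.single i 1 + (I - Pi.single i 1)) : MIdx n)
        = unitIdx (some i) + (0, I - Pi.single i 1) from rfl]
      exact this
  | succ k ih =>
    have := add none _ ih
    convert this using 1
    simp [unitIdx, add_comm]

/-- The sign `(-1)^|q|`. -/
def sgn (q : MIdx n) : ℝ := (-1) ^ (q.1 + order q.2)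

theorem sgn_zero : sgn (0 : MIdx n) = 1 := by simp [sgn, order]

theorem sgn_add (q r : MIdx n) : sgn (q + r) = sgn q * sgn r := by
  simp only [sgn, order, Prod.fst_add, Prod.snd_add, Pi.add_apply, Finset.sum_add_distrib,
    ← pow_add]
  congr 1; omega

theorem sgn_unit (i : Option (Fin n)) : sgn (unitIdx i) = -1 := by
  cases i <;> simp [sgn, unitIdx, order]

theorem sgn_mul_self (q : MIdx n) : sgn q * sgn q = 1 := by
  rw [sgn, ← mul_pow]; simp

end TotalDerivatives

/-! ### Linearization, formal adjoints and the Euler operator -/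

section DifferentialOperators

open Topology TopologicalSpace

variable {U : Opens (Jet n N)}

theorem DD_coordU (q : MIdx n) (c : JetIdx n N) :
    DD q (coordU c : DiffAlg U) = coordU (c.1, c.2 + q) := by
  induction q using MIdx.induction with
  | zero => rw [DD_zero, add_zero]; rfl
  | add i q ih => rw [DD_unit_add, ih, D_coordU, shift, add_comm (unitIdx i), ← add_assoc]

/-- The partial derivatives with respect to the derivatives of `u^σ`. -/
def gradAt (σ : Fin N) : Derivation ℝ (DiffAlg U) (MIdx n →₀ DiffAlg U) :=
  (Finsupp.lcomapDomain (M := DiffAlg U) (R := DiffAlg U) (fun q : MIdx n => (σ, q))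
    (Prod.mk_right_injective σ)).compDer grad

theorem gradAt_apply (σ : Fin N) (f : DiffAlg U) (q : MIdx n) :
    gradAt σ f q = pd (dirU (σ, q)) f := rfl

theorem gradAt_coordU (σ ρ : Fin N) (r : MIdx n) :
    gradAt σ (coordU (ρ, r) : DiffAlg U) = if ρ = σ then Finsupp.single r 1 else 0 := by
  ext1 q
  rw [gradAt_apply, pd_dirU_coordU]
  by_cases h : ρ = σ
  · simp [h, Finsupp.single_apply]
  · simp [h]

/-- The coefficients of `D_i ∘ A` for a differential operator `A` with coefficients `c`. -/
def leftD (i : Option (Fin n)) (c : MIdx n →₀ DiffAlg U) : MIdx n →₀ DiffAlg U :=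
  c.mapRange (D i) (map_zero _) + c.mapDomain (· + unitIdx i)

theorem leftD_add (i : Option (Fin n)) (c d : MIdx n →₀ DiffAlg U) :
    leftD i (c + d) = leftD i c + leftD i d := by
  rw [leftD, Finsupp.mapRange_add (map_add _), Finsupp.mapDomain_add, leftD, leftD]
  abel

theorem leftD_zero (i : Option (Fin n)) : leftD i (0 : MIdx n →₀ DiffAlg U) = 0 := by
  simp [leftD]

theorem leftD_single (i : Option (Fin n)) (q : MIdx n) (a : DiffAlg U) :
    leftD i (Finsupp.single q a) = Finsupp.single q (D i a) + Finsupp.single (q + unitIdx i) a := by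
  rw [leftD, Finsupp.mapRange_single, Finsupp.mapDomain_single]

/-- The linearization of D_i f is D_i composed with the linearization of f. This is `grad_D` sorted
by dependent variable; an index `d` without an i-th derivative receives no shifted term. -/
theorem gradAt_D (σ : Fin N) (i : Option (Fin n)) (f : DiffAlg U) :
    gradAt σ (D i f) = leftD i (gradAt σ f) := by
  ext1 d
  have h : gradAt σ (D i f) d = grad (D i f) (σ, d) := rfl
  rw [h, grad_D, leftD, Finsupp.add_apply, Finsupp.add_apply, Finsupp.mapRange_apply,
    Finsupp.mapRange_apply]
  have hinj : Function.Injective (shift i : JetIdx n N → JetIdx n N) := by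
    rintro ⟨a, q⟩ ⟨b, r⟩ hqr
    simp only [shift, Prod.mk.injEq] at hqr
    rw [hqr.1, add_right_cancel hqr.2]
  congr 1
  by_cases hd : ∃ q, q + unitIdx i = d
  · obtain ⟨q, rfl⟩ := hd
    rw [Finsupp.mapDomain_apply (add_left_injective _)]
    exact Finsupp.mapDomain_apply hinj (grad f) (σ, q)
  · rw [Finsupp.mapDomain_of_notMem_range, Finsupp.mapDomain_of_notMem_range]
    · exact hd
    · rintro ⟨c, hc⟩
      exact hd ⟨c.2, congrArg Prod.snd hc⟩

/-- The value `∑_q c_q D_q V` at `V` of the differential operator with coefficients `c`. -/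
def Op (V : DiffAlg U) : (MIdx n →₀ DiffAlg U) →ₗ[ℝ] DiffAlg U :=
  Finsupp.lsum ℝ fun q => LinearMap.mulRight ℝ (DD q V)

/-- The value `∑_q (-D)_q (c_q V)` at `V` of the formal adjoint of the differential operator with
coefficients `c`. -/
def Adj (V : DiffAlg U) : (MIdx n →₀ DiffAlg U) →ₗ[ℝ] DiffAlg U :=
  Finsupp.lsum ℝ fun q => sgn q • (DD q).comp (LinearMap.mulRight ℝ V)

theorem Op_single (V : DiffAlg U) (q : MIdx n) (a : DiffAlg U) :
    Op V (Finsupp.single q a) = a * DD q V := by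
  rw [Op, Finsupp.lsum_single]; rfl

theorem Adj_single (V : DiffAlg U) (q : MIdx n) (a : DiffAlg U) :
    Adj V (Finsupp.single q a) = sgn q • DD q (a * V) := by
  rw [Adj, Finsupp.lsum_single]; rfl

theorem Op_apply (V : DiffAlg U) (c : MIdx n →₀ DiffAlg U) :
    Op V c = ∑ q ∈ c.support, c q * DD q V := by
  conv_lhs => rw [← c.sum_single, Finsupp.sum, map_sum]
  simp only [Op_single]

theorem Adj_apply (V : DiffAlg U) (c : MIdx n →₀ DiffAlg U) :
    Adj V c = ∑ q ∈ c.support, sgn q • DD q (c q * V) := by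
  conv_lhs => rw [← c.sum_single, Finsupp.sum, map_sum]
  simp only [Adj_single]

theorem Op_add_left (V W : DiffAlg U) (c : MIdx n →₀ DiffAlg U) :
    Op (V + W) c = Op V c + Op W c := by
  simp only [Op_apply, map_add, mul_add, Finset.sum_add_distrib]

theorem Adj_smul_left (r : ℝ) (V : DiffAlg U) (c : MIdx n →₀ DiffAlg U) :
    Adj (r • V) c = r • Adj V c := by
  simp only [Adj_apply, mul_smul_comm, map_smul, Finset.smul_sum, smul_comm r]

theorem Adj_smul (V f : DiffAlg U) (c : MIdx n →₀ DiffAlg U) : Adj V (f • c) = Adj (f * V) c := by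
  induction c using Finsupp.induction_linear with
  | zero => simp
  | add c d hc hd => rw [smul_add, map_add, map_add, hc, hd]
  | single q a =>
    rw [Finsupp.smul_single, Adj_single, Adj_single, smul_eq_mul, mul_comm f a, mul_assoc]

theorem Op_leftD (V : DiffAlg U) (i : Option (Fin n)) (c : MIdx n →₀ DiffAlg U) :
    Op V (leftD i c) = D i (Op V c) := by
  induction c using Finsupp.induction_linear with
  | zero => rw [leftD_zero, map_zero, map_zero]
  | add c d hc hd => rw [leftD_add, map_add, hc, hd, map_add, map_add]
  | single q a =>
    rw [leftD_single, map_add, Op_single, Op_single, Op_single, DD_add_unit, Derivation.leibniz,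
      smul_eq_mul, smul_eq_mul]
    ring

/-- Taking adjoints reverses composition, and the adjoint of D_i is -D_i. -/
theorem Adj_leftD (V : DiffAlg U) (i : Option (Fin n)) (c : MIdx n →₀ DiffAlg U) :
    Adj V (leftD i c) = Adj (-D i V) c := by
  induction c using Finsupp.induction_linear with
  | zero => rw [leftD_zero, map_zero, map_zero]
  | add c d hc hd => rw [leftD_add, map_add, hc, hd, map_add]
  | single q a =>
    rw [leftD_single, map_add, Adj_single, Adj_single, Adj_single, DD_add_unit, ← DD_D, sgn_add,
      sgn_unit, mul_neg_one, neg_smul, ← smul_neg, ← smul_add, ← map_neg, ← map_add,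
      Derivation.leibniz, smul_eq_mul, smul_eq_mul]
    congr 2
    ring

/-- Linearization commutes with iterated total derivatives. -/
theorem Op_gradAt_DD (V : DiffAlg U) (σ : Fin N) (q : MIdx n) (f : DiffAlg U) :
    Op V (gradAt σ (DD q f)) = DD q (Op V (gradAt σ f)) := by
  induction q using MIdx.induction with
  | zero => rw [DD_zero]; rfl
  | add i q ih => rw [DD_unit_add, gradAt_D, Op_leftD, ih, DD_unit_add]

/-- The linearization of D_q f is D_q ∘ L_f, whose adjoint is L_f* ∘ (-D)_q. -/
theorem Adj_gradAt_DD (V : DiffAlg U) (σ : Fin N) (q : MIdx n) (f : DiffAlg U) :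
    Adj V (gradAt σ (DD q f)) = sgn q • Adj (DD q V) (gradAt σ f) := by
  induction q using MIdx.induction generalizing V with
  | zero => rw [DD_zero, sgn_zero, one_smul]; rfl
  | add i q ih =>
    rw [DD_unit_add, gradAt_D, Adj_leftD, ih, map_neg, DD_unit_add, DD_D, sgn_add, sgn_unit,
      ← neg_one_smul ℝ (D i (DD q V)), Adj_smul_left, smul_smul, mul_comm]

/-- The Euler operator, with derivatives with respect to `t` and `x`. -/
def Eul (σ : Fin N) : DiffAlg U →ₗ[ℝ] DiffAlg U := (Adj 1).comp (gradAt σ).toLinearMap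

theorem Eul_apply (σ : Fin N) (f : DiffAlg U) : Eul σ f = Adj 1 (gradAt σ f) := rfl

/-- The Euler operator annihilates total derivatives. -/
theorem Eul_D (σ : Fin N) (i : Option (Fin n)) (f : DiffAlg U) : Eul σ (D i f) = 0 := by
  rw [Eul_apply, gradAt_D, Adj_leftD, Derivation.map_one_eq_zero, neg_zero]
  have h := Adj_smul_left 0 0 (gradAt σ f)
  rwa [zero_smul, zero_smul] at h

/-- The linearization of `f * h` is f L_h + h L_f; in the adjoint the outer factors become
arguments. -/
theorem Eul_mul (σ : Fin N) (f h : DiffAlg U) :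
    Eul σ (f * h) = Adj h (gradAt σ f) + Adj f (gradAt σ h) := by
  rw [Eul_apply, Derivation.leibniz, map_add, Adj_smul, Adj_smul, mul_one, mul_one, add_comm]

/-- The linearization of an Euler-Lagrange expression is formally self-adjoint. -/
theorem Op_gradAt_Eul (V P : DiffAlg U) (σ ρ : Fin N) :
    Op V (gradAt ρ (Eul σ P)) = Adj V (gradAt σ (Eul ρ P)) := by
  have hE : ∀ τ : Fin N, Eul τ P = ∑ q ∈ (gradAt τ P).support, sgn q • DD q (gradAt τ P q) := by
    intro τ
    rw [Eul_apply, Adj_apply]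
    simp only [mul_one]
  -- Both sides are the double sum of (-1)^|r| D_r((∂²P/∂u^ρ_q ∂u^σ_r) D_q V). On the left,
  -- linearization passes through D_r. On the right, `Adj_gradAt_DD` moves D_q onto V with a second
  -- sign (-1)^|q|, which cancels the first.
  have hL : Op V (gradAt ρ (Eul σ P)) = ∑ r ∈ (gradAt σ P).support,
      ∑ q ∈ (gradAt ρ P).support, sgn r • DD r (pd (dirU (ρ, q)) (gradAt σ P r) * DD q V) := by
    rw [hE, map_sum, map_sum]
    refine Finset.sum_congr rfl fun r _ => ?_
    rw [(gradAt ρ).map_smul, map_smul, Op_gradAt_DD, ← Finset.smul_sum, ← map_sum, Op_apply]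
    congr 2
    refine Finset.sum_subset (fun q hq => ?_) fun q _ hq => ?_
    · rw [Finsupp.mem_support_iff, gradAt_apply, gradAt_apply, pd_comm] at hq
      rw [Finsupp.mem_support_iff, gradAt_apply]
      exact fun h => hq (by rw [h, map_zero])
    · rw [Finsupp.notMem_support_iff.1 hq, zero_mul]
  have hR : Adj V (gradAt σ (Eul ρ P)) = ∑ q ∈ (gradAt ρ P).support,
      ∑ r ∈ (gradAt σ P).support, sgn r • DD r (pd (dirU (σ, r)) (gradAt ρ P q) * DD q V) := by
    rw [hE, map_sum, map_sum]
    refine Finset.sum_congr rfl fun q _ => ?_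
    rw [(gradAt σ).map_smul, map_smul, Adj_gradAt_DD, smul_smul, sgn_mul_self, one_smul, Adj_apply]
    refine Finset.sum_subset (fun r hr => ?_) fun r _ hr => ?_
    · rw [Finsupp.mem_support_iff, gradAt_apply, gradAt_apply, pd_comm] at hr
      rw [Finsupp.mem_support_iff, gradAt_apply]
      exact fun h => hr (by rw [h, map_zero])
    · rw [Finsupp.notMem_support_iff.1 hr, zero_mul, map_zero, smul_zero]
  rw [hL, hR, Finset.sum_comm]
  simp only [gradAt_apply]
  refine Finset.sum_congr rfl fun q _ => Finset.sum_congr rfl fun r _ => ?_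
  rw [pd_comm]

/-! ### Total divergences -/

/-- The map `(Φ_i)_i ↦ ∑_i D_i Φ_i`. -/
def divergence : (Option (Fin n) → DiffAlg U) →ₗ[ℝ] DiffAlg U :=
  ∑ i, (De i).comp (LinearMap.proj i)

theorem divergence_apply (Φ : Option (Fin n) → DiffAlg U) : divergence Φ = ∑ i, D i (Φ i) := by
  simp only [divergence, LinearMap.sum_apply]; rfl

theorem Eul_divergence (σ : Fin N) (Φ : Option (Fin n) → DiffAlg U) :
    Eul σ (divergence Φ) = 0 := by
  rw [divergence_apply, map_sum]
  exact Finset.sum_eq_zero fun i _ => Eul_D σ i _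

theorem D_mem_range_divergence (i : Option (Fin n)) (f : DiffAlg U) :
    D i f ∈ LinearMap.range (divergence (U := U)) := by
  refine ⟨Pi.single i f, ?_⟩
  rw [divergence_apply, Finset.sum_eq_single i]
  · rw [Pi.single_eq_same]
  · intro j _ hj
    rw [Pi.single_eq_of_ne hj, map_zero]
  · exact fun h => absurd (Finset.mem_univ i) h

/-- Repeated integration by parts: taking one D_i off D_i D_q w costs the divergence D_i(D_q w · f)
and a sign, and what remains is the case of q with D_i f in place of f. -/
theorem DD_mul_sub_mem_range_divergence (q : MIdx n) (w f : DiffAlg U) :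
    DD q w * f - sgn q • (w * DD q f) ∈ LinearMap.range (divergence (U := U)) := by
  induction q using MIdx.induction generalizing f with
  | zero =>
    rw [DD_zero, sgn_zero, one_smul]
    simp
  | add i q ih =>
    have h := Submodule.sub_mem _ (D_mem_range_divergence i (DD q w * f)) (ih (D i f))
    convert h using 1
    rw [Derivation.leibniz, smul_eq_mul, smul_eq_mul, DD_unit_add, DD_unit_add, DD_D, sgn_add,
      sgn_unit, neg_one_mul, neg_smul]
    ring

/-- Integration by parts for a differential operator. -/
theorem Op_sub_mem_range_divergence (w : DiffAlg U) (c : MIdx n →₀ DiffAlg U) :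
    Op w c - w * Adj 1 c ∈ LinearMap.range (divergence (U := U)) := by
  induction c using Finsupp.induction_linear with
  | zero => simp
  | add c d hc hd =>
    convert Submodule.add_mem _ hc hd using 1
    rw [map_add, map_add]; ring
  | single q a =>
    convert DD_mul_sub_mem_range_divergence q w a using 1
    rw [Op_single, Adj_single, mul_one, mul_smul_comm, mul_comm]

/-- The coefficients belonging to the derivatives of `u^ρ`. -/
def compAt (ρ : Fin N) : (JetIdx n N →₀ DiffAlg U) →ₗ[DiffAlg U] (MIdx n →₀ DiffAlg U) :=
  Finsupp.lcomapDomain (fun q : MIdx n => (ρ, q)) (Prod.mk_right_injective ρ)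

theorem compAt_apply (ρ : Fin N) (g : JetIdx n N →₀ DiffAlg U) (q : MIdx n) :
    compAt ρ g q = g (ρ, q) := rfl

/-- A sum over all jet coordinates (ρ, q), regrouped into one differential operator for each
dependent variable. -/
theorem sum_Op_compAt (W : Fin N → DiffAlg U) (g : JetIdx n N →₀ DiffAlg U) :
    ∑ ρ, Op (W ρ) (compAt ρ g)
      = Finsupp.linearCombination (DiffAlg U) (fun c => DD c.2 (W c.1)) g := by
  classical
  induction g using Finsupp.induction_linear with
  | zero => simp
  | add g h hg hh => simp only [map_add, Finset.sum_add_distrib, hg, hh]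
  | single c a =>
    rw [Finsupp.linearCombination_single, Finset.sum_eq_single c.1]
    · have : compAt c.1 (Finsupp.single c a) = Finsupp.single c.2 a := by
        ext1 q
        rw [compAt_apply, Finsupp.single_apply, Finsupp.single_apply]
        exact if_congr ⟨fun h => congrArg Prod.snd h, fun h => Prod.ext rfl h⟩ rfl rfl
      rw [this, Op_single, smul_eq_mul]
    · intro ρ _ hρ
      have : compAt ρ (Finsupp.single c a) = 0 := by
        ext1 q
        rw [compAt_apply, Finsupp.single_apply, if_neg fun h => hρ (congrArg Prod.fst h).symm]
        rfl
      rw [this, map_zero]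
    · exact fun h => absurd (Finset.mem_univ _) h

/-- The derivation along `W` expressed through the linearization operators. -/
theorem sum_Op_gradAt (W : Fin N → DiffAlg U) (f : DiffAlg U) :
    ∑ ρ, Op (W ρ) (gradAt ρ f)
      = Finsupp.linearCombination (DiffAlg U) (fun c => DD c.2 (W c.1)) (grad f) :=
  sum_Op_compAt W (grad f)

end DifferentialOperators

/-! ### The Leibniz rule and the coefficients of the adjoint -/

section AdjointCoefficients

open Topology TopologicalSpace
open scoped Classical

variable {U : Opens (Jet n N)}

/-- The component of a multi-index belonging to an independent variable. -/
def MIdx.comp (q : MIdx n) : Option (Fin n) → ℕ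
  | none => q.1
  | some i => q.2 i

theorem MIdx.le_iff {q r : MIdx n} : q ≤ r ↔ ∀ o, q.comp o ≤ r.comp o := by
  rw [Prod.le_def, Pi.le_def, Option.forall]
  rfl

theorem MIdx.ext_comp {q r : MIdx n} (h : ∀ o, q.comp o = r.comp o) : q = r :=
  Prod.ext (h none) (funext fun i => h (some i))

theorem MIdx.comp_add (q r : MIdx n) (o : Option (Fin n)) :
    (q + r).comp o = q.comp o + r.comp o := by cases o <;> rfl

theorem MIdx.comp_sub (q r : MIdx n) (o : Option (Fin n)) :
    (q - r).comp o = q.comp o - r.comp o := by cases o <;> rfl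

theorem MIdx.comp_unitIdx (i o : Option (Fin n)) :
    (unitIdx i).comp o = if o = i then 1 else 0 := by
  cases i <;> cases o <;> simp [unitIdx, MIdx.comp, Pi.single_apply]

/-- The binomial coefficient of multi-indices. -/
def binom (q r : MIdx n) : ℕ := ∏ o, (q.comp o).choose (r.comp o)

theorem binom_zero_right (q : MIdx n) : binom q 0 = 1 :=
  Finset.prod_eq_one fun o _ => by cases o <;> exact Nat.choose_zero_right _

theorem binom_eq_zero {q r : MIdx n} (h : ¬r ≤ q) : binom q r = 0 := by
  rw [MIdx.le_iff] at h
  push Not at h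
  obtain ⟨o, ho⟩ := h
  exact Finset.prod_eq_zero (Finset.mem_univ o) (Nat.choose_eq_zero_of_lt ho)

theorem unitIdx_le_iff {i : Option (Fin n)} {r : MIdx n} : unitIdx i ≤ r ↔ r.comp i ≠ 0 := by
  rw [MIdx.le_iff]
  constructor
  · intro h
    have := h i
    rw [MIdx.comp_unitIdx, if_pos rfl] at this
    omega
  · intro h o
    rw [MIdx.comp_unitIdx]
    split_ifs with ho
    · subst ho; omega
    · omega

/-- Pascal's rule. -/
theorem binom_unit_add (i : Option (Fin n)) (q r : MIdx n) :
    binom (unitIdx i + q) r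
      = binom q r + if unitIdx i ≤ r then binom q (r - unitIdx i) else 0 := by
  classical
  have split : ∀ q r : MIdx n, binom q r = (q.comp i).choose (r.comp i) *
      ∏ o ∈ Finset.univ.erase i, (q.comp o).choose (r.comp o) := fun q r =>
    (Finset.mul_prod_erase _ _ (Finset.mem_univ i)).symm
  have h1 : ∏ o ∈ Finset.univ.erase i, ((unitIdx i + q).comp o).choose (r.comp o)
      = ∏ o ∈ Finset.univ.erase i, (q.comp o).choose (r.comp o) := by
    refine Finset.prod_congr rfl fun o ho => ?_
    rw [MIdx.comp_add, MIdx.comp_unitIdx, if_neg (Finset.ne_of_mem_erase ho), zero_add]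
  have h2 : ∏ o ∈ Finset.univ.erase i, (q.comp o).choose ((r - unitIdx i).comp o)
      = ∏ o ∈ Finset.univ.erase i, (q.comp o).choose (r.comp o) := by
    refine Finset.prod_congr rfl fun o ho => ?_
    rw [MIdx.comp_sub, MIdx.comp_unitIdx, if_neg (Finset.ne_of_mem_erase ho), tsub_zero]
  rw [split, split q r, split q (r - _), h1, h2, MIdx.comp_add, MIdx.comp_sub, MIdx.comp_unitIdx,
    if_pos rfl]
  split_ifs with h <;> rw [unitIdx_le_iff] at h
  · obtain ⟨m, hm⟩ := Nat.exists_eq_succ_of_ne_zero h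
    rw [hm, add_comm 1, Nat.choose_succ_succ, Nat.succ_eq_add_one, Nat.add_sub_cancel]
    ring
  · rw [not_not.1 h, Nat.choose_zero_right, Nat.choose_zero_right, add_zero]

/-- The Leibniz rule for iterated total derivatives. -/
theorem DD_mul (q : MIdx n) (f V : DiffAlg U) :
    DD q (f * V) = ∑ r ∈ Finset.Iic q, binom q r • (DD (q - r) f * DD r V) := by
  induction q using MIdx.induction with
  | zero =>
    have : Finset.Iic (0 : MIdx n) = {0} := by
      ext r
      rw [Finset.mem_Iic, Finset.mem_singleton, nonpos_iff_eq_zero]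
    rw [this, Finset.sum_singleton, binom_zero_right, one_smul, tsub_zero, DD_zero]
    rfl
  | add i q ih =>
    have hl : DD (unitIdx i + q) (f * V)
        = ∑ r ∈ Finset.Iic q, binom q r • (DD (unitIdx i + (q - r)) f * DD r V)
          + ∑ r ∈ Finset.Iic q, binom q r • (DD (q - r) f * DD (unitIdx i + r) V) := by
      rw [DD_unit_add, ih, map_sum, ← Finset.sum_add_distrib]
      refine Finset.sum_congr rfl fun r _ => ?_
      rw [map_nsmul, Derivation.leibniz, ← smul_add, DD_unit_add, DD_unit_add, smul_eq_mul,
        smul_eq_mul]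
      congr 1
      ring
    -- Both halves of the product rule are rewritten as sums over `Finset.Iic (unitIdx i + q)`: the
    -- first is padded by vanishing binomials, the second is shifted by a unit. Pascal's rule then
    -- adds them.
    have h1 : ∑ r ∈ Finset.Iic q, binom q r • (DD (unitIdx i + (q - r)) f * DD r V)
        = ∑ r ∈ Finset.Iic (unitIdx i + q),
          binom q r • (DD (unitIdx i + q - r) f * DD r V) := by
      refine Finset.sum_subset_zero_on_sdiff ?_ (fun r hr => ?_) fun r hr => ?_
      · intro r hr
        rw [Finset.mem_Iic] at hr ⊢
        exact hr.trans le_add_self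
      · rw [Finset.mem_sdiff, Finset.mem_Iic, Finset.mem_Iic] at hr
        rw [binom_eq_zero hr.2, zero_smul]
      · have : unitIdx i + (q - r) = unitIdx i + q - r := MIdx.ext_comp fun o => by
          have := MIdx.le_iff.1 (Finset.mem_Iic.1 hr) o
          simp only [MIdx.comp_add, MIdx.comp_sub]
          omega
        rw [this]
    have h2 : ∑ r ∈ Finset.Iic q, binom q r • (DD (q - r) f * DD (unitIdx i + r) V)
        = ∑ r ∈ Finset.Iic (unitIdx i + q),
          (if unitIdx i ≤ r then binom q (r - unitIdx i) else 0) •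
            (DD (unitIdx i + q - r) f * DD r V) := by
      classical
      simp only [ite_smul, zero_smul]
      rw [← Finset.sum_filter]
      have hsub : ∀ r : MIdx n, unitIdx i + r - unitIdx i = r := fun r => MIdx.ext_comp fun o => by
        simp only [MIdx.comp_add, MIdx.comp_sub]; omega
      refine Finset.sum_nbij' (fun r => unitIdx i + r) (fun r => r - unitIdx i) ?_ ?_ ?_ ?_ ?_
      · intro r hr
        rw [Finset.mem_Iic] at hr
        rw [Finset.mem_filter, Finset.mem_Iic]
        exact ⟨by gcongr, le_self_add⟩
      · intro r hr
        rw [Finset.mem_filter, Finset.mem_Iic, MIdx.le_iff] at hr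
        rw [Finset.mem_Iic, MIdx.le_iff]
        intro o
        have := hr.1 o
        rw [MIdx.comp_add] at this
        rw [MIdx.comp_sub]
        omega
      · exact fun r _ => hsub r
      · intro r hr
        have h := MIdx.le_iff.1 (Finset.mem_filter.1 hr).2
        refine MIdx.ext_comp fun o => ?_
        have := h o
        rw [MIdx.comp_add, MIdx.comp_sub]
        omega
      · intro r _
        have : unitIdx i + q - (unitIdx i + r) = q - r := MIdx.ext_comp fun o => by
          simp only [MIdx.comp_add, MIdx.comp_sub]; omega
        rw [hsub, this]
    rw [hl, h1, h2, ← Finset.sum_add_distrib]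
    refine Finset.sum_congr rfl fun r _ => ?_
    rw [binom_unit_add, add_smul]

/-- The coefficients of the formal adjoint of the differential operator with coefficients `c`. -/
def adjCoef : (MIdx n →₀ DiffAlg U) →ₗ[ℝ] (MIdx n →₀ DiffAlg U) :=
  Finsupp.lsum ℝ fun q => ∑ r ∈ Finset.Iic q,
    (sgn q * binom q r : ℝ) • (Finsupp.lsingle r).comp (DD (U := U) (q - r))

theorem adjCoef_single (q : MIdx n) (a : DiffAlg U) :
    adjCoef (Finsupp.single q a) = ∑ r ∈ Finset.Iic q,
      (sgn q * binom q r) • Finsupp.single r (DD (q - r) a) := by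
  rw [adjCoef, Finsupp.lsum_single, LinearMap.sum_apply]
  rfl

theorem Op_adjCoef (V : DiffAlg U) (c : MIdx n →₀ DiffAlg U) : Op V (adjCoef c) = Adj V c := by
  induction c using Finsupp.induction_linear with
  | zero => rw [map_zero, map_zero, map_zero]
  | add c d hc hd => rw [map_add, map_add, map_add, hc, hd]
  | single q a =>
    rw [adjCoef_single, map_sum, Adj_single, DD_mul, Finset.smul_sum]
    refine Finset.sum_congr rfl fun r _ => ?_
    rw [map_smul, Op_single, mul_smul, Nat.cast_smul_eq_nsmul]

/-- The coefficients of the adjoint in closed form. -/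
theorem adjCoef_apply (c : MIdx n →₀ DiffAlg U) (r : MIdx n) :
    adjCoef c r = ∑ q ∈ c.support, (sgn q * binom q r) • DD (q - r) (c q) := by
  conv_lhs => rw [← c.sum_single, Finsupp.sum, map_sum, Finsupp.finsetSum_apply]
  refine Finset.sum_congr rfl fun q _ => ?_
  rw [adjCoef_single, Finsupp.finsetSum_apply]
  simp only [Finsupp.smul_apply, Finsupp.single_apply, smul_ite, smul_zero, Finset.sum_ite_eq']
  split_ifs with h
  · rfl
  · rw [Finset.mem_Iic] at h
    rw [binom_eq_zero h, Nat.cast_zero, mul_zero, zero_smul]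

/-- Applied to u^ρ_r the operator gives ∑_s c_s u^ρ_{r+s}, which is linear in the coordinate
u^τ_{r+q} when no coefficient contains it. This is the device for reading off coefficients, here and
in `Eul_sum_mul_eq_zero_iff`. -/
theorem pd_Op_coordU {ρ τ : Fin N} {r q : MIdx n} {c : MIdx n →₀ DiffAlg U}
    (hc : ∀ s, pd (dirU (τ, r + q)) (c s) = 0) :
    pd (dirU (τ, r + q)) (Op (coordU (ρ, r)) c) = if ρ = τ then c q else 0 := by
  rw [Op_apply, map_sum]
  have : ∀ s ∈ c.support, pd (dirU (τ, r + q)) (c s * DD s (coordU (ρ, r)))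
      = if s = q then (if ρ = τ then c q else 0) else 0 := by
    intro s _
    rw [Derivation.leibniz, hc, smul_zero, add_zero, DD_coordU, pd_dirU_coordU, smul_eq_mul]
    by_cases hs : s = q
    · subst hs
      by_cases h : ρ = τ
      · rw [if_pos (by rw [h]), if_pos rfl, if_pos h, mul_one]
      · rw [if_neg (fun h' => h (congrArg Prod.fst h')), if_pos rfl, if_neg h, mul_zero]
    · rw [if_neg (fun h' => hs (add_left_cancel (congrArg Prod.snd h'))), if_neg hs, mul_zero]
  rw [Finset.sum_congr rfl this, Finset.sum_ite_eq']
  split_ifs with h1 h2 h2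
  · rfl
  · rfl
  · exact (Finsupp.notMem_support_iff.1 h1).symm
  · rfl

/-- A differential operator which vanishes on all differential functions has zero coefficients. -/
theorem eq_zero_of_Op_eq_zero (ρ : Fin N) {c : MIdx n →₀ DiffAlg U} (hc : ∀ V, Op V c = 0) :
    c = 0 := by
  classical
  set S := c.support.biUnion fun q => (grad (c q)).support with hS
  -- `k` exceeds every t-order occurring in the coefficients, so none of them contains a derivative
  -- of the test function u^ρ_{k,0}.
  set k := S.sup (fun d => d.2.1) + 1 with hk
  ext1 q
  have h := pd_Op_coordU (ρ := ρ) (τ := ρ) (r := (k, 0)) (q := q) (c := c) (by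
    intro s
    by_contra hs
    have hcs : c s ≠ 0 := fun h => hs (by rw [h, map_zero])
    have hmem : ((ρ, (k, 0) + q) : JetIdx n N) ∈ S :=
      Finset.mem_biUnion.2 ⟨s, Finsupp.mem_support_iff.2 hcs, Finsupp.mem_support_iff.2 hs⟩
    have := Finset.le_sup (f := fun d : JetIdx n N => d.2.1) hmem
    simp only [Prod.fst_add] at this
    omega)
  rw [hc, map_zero, if_pos rfl] at h
  exact h.symm

/-- Formal self-adjointness in terms of coefficients. -/
theorem Op_eq_Adj_iff (ρ : Fin N) (c d : MIdx n →₀ DiffAlg U) :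
    (∀ V, Op V c = Adj V d) ↔ c = adjCoef d := by
  constructor
  · intro h
    rw [← sub_eq_zero]
    refine eq_zero_of_Op_eq_zero ρ fun V => ?_
    rw [map_sub, h, Op_adjCoef, sub_self]
  · rintro rfl V
    exact Op_adjCoef V d

end AdjointCoefficients

/-! ### Functions without t-derivatives, and the Euler operator on ∑ (u^ρ_t + g^ρ) Λ_ρ -/

section Spatial

open Topology TopologicalSpace

variable {U : Opens (Jet n N)}

/-- The differential functions which do not depend on `t`-derivatives of `u`. -/
def Spatial (U : Opens (Jet n N)) : Subalgebra ℝ (DiffAlg U) where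
  carrier := {f | ∀ c : JetIdx n N, c.2.1 ≠ 0 → pd (dirU c) f = 0}
  mul_mem' hf hg c hc := by
    rw [Derivation.leibniz, hf c hc, hg c hc, smul_zero, smul_zero, add_zero]
  add_mem' hf hg c hc := by rw [map_add, hf c hc, hg c hc, add_zero]
  algebraMap_mem' r c _ := Derivation.map_algebraMap _ r

theorem pd_mem_spatial {f : DiffAlg U} (hf : f ∈ Spatial U) (v : Jet n N) :
    pd v f ∈ Spatial U := fun c hc => by
  rw [pd_comm, hf c hc, map_zero]

/-- By `gradAt_D` the derivatives of D_i f with respect to coordinates of a given t-order involve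
only those of f of the same t-order, since D_i shifts x-indices alone. -/
theorem D_mem_spatial {f : DiffAlg U} (hf : f ∈ Spatial U) (i : Fin n) :
    D (some i) f ∈ Spatial U := fun c hc => by
  have h : pd (dirU c) (D (some i) f) = leftD (some i) (gradAt c.1 f) c.2 := by
    rw [← gradAt_D]; rfl
  rw [h, leftD, Finsupp.add_apply, Finsupp.mapRange_apply, gradAt_apply, hf c hc, map_zero,
    zero_add]
  by_cases hd : ∃ q, q + unitIdx (some i) = c.2
  · obtain ⟨q, hq⟩ := hd
    have hq1 : q.1 = c.2.1 := by rw [← hq]; rfl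
    rw [← hq, Finsupp.mapDomain_apply (add_left_injective _)]
    exact hf (c.1, q) (by simpa only [hq1] using hc)
  · exact Finsupp.mapDomain_of_notMem_range _ _ (by simpa only [Set.mem_range] using hd)

theorem DD_mem_spatial {f : DiffAlg U} (hf : f ∈ Spatial U) {q : MIdx n} (hq : q.1 = 0) :
    DD q f ∈ Spatial U := by
  induction q using MIdx.induction with
  | zero => rwa [DD_zero]
  | add i q ih =>
    rw [DD_unit_add]
    cases i with
    | none => simp [unitIdx] at hq
    | some i => exact D_mem_spatial (ih (by simpa [unitIdx] using hq)) i

theorem fst_eq_zero_of_gradAt {f : DiffAlg U} (hf : f ∈ Spatial U) {σ : Fin N} {q : MIdx n}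
    (hq : q ∈ (gradAt σ f).support) : q.1 = 0 := by
  by_contra h
  exact (Finsupp.mem_support_iff.1 hq) (hf (σ, q) h)

theorem Adj_mem_spatial {f V : DiffAlg U} (hf : f ∈ Spatial U) (hV : V ∈ Spatial U) (σ : Fin N) :
    Adj V (gradAt σ f) ∈ Spatial U := by
  rw [Adj_apply]
  exact Subalgebra.sum_mem _ fun q hq => Subalgebra.smul_mem _ (DD_mem_spatial
    (Subalgebra.mul_mem _ (pd_mem_spatial hf _) hV) (fst_eq_zero_of_gradAt hf hq)) _

theorem adjCoef_mem_spatial {f : DiffAlg U} (hf : f ∈ Spatial U) (σ : Fin N) (r : MIdx n) :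
    adjCoef (gradAt σ f) r ∈ Spatial U := by
  rw [adjCoef_apply]
  exact Subalgebra.sum_mem _ fun q hq => Subalgebra.smul_mem _ (DD_mem_spatial
    (pd_mem_spatial hf _) (by
      rw [Prod.fst_sub, fst_eq_zero_of_gradAt hf hq, Nat.zero_sub])) _

theorem adjCoef_eq_zero {f : DiffAlg U} (hf : f ∈ Spatial U) {σ : Fin N} {r : MIdx n}
    (hr : r.1 ≠ 0) : adjCoef (gradAt σ f) r = 0 := by
  rw [adjCoef_apply]
  refine Finset.sum_eq_zero fun q hq => ?_
  rw [binom_eq_zero, Nat.cast_zero, mul_zero, zero_smul]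
  intro h
  have := h.1
  rw [fst_eq_zero_of_gradAt hf hq] at this
  omega

theorem Op_mem_spatial {V : DiffAlg U} (hV : V ∈ Spatial U) {c : MIdx n →₀ DiffAlg U}
    (hc : ∀ q, c q ∈ Spatial U) (hc0 : ∀ q : MIdx n, q.1 ≠ 0 → c q = 0) :
    Op V c ∈ Spatial U := by
  rw [Op_apply]
  refine Subalgebra.sum_mem _ fun q hq => Subalgebra.mul_mem _ (hc q) (DD_mem_spatial hV ?_)
  by_contra h
  exact (Finsupp.mem_support_iff.1 hq) (hc0 q h)

/-- The total `t`-derivative on the solution space. -/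
def solD (g : Fin N → DiffAlg U) (f : DiffAlg U) : DiffAlg U :=
  pd (dirB (indepDir none)) f - ∑ ρ, Op (g ρ) (gradAt ρ f)

/-- The coordinate `u^ρ_t`. -/
def coordT (ρ : Fin N) : DiffAlg U := coordU (ρ, (1, 0))

/-- D_t differentiates u^ρ_q along D_q u^ρ_t, and `solD` along -D_q g^ρ. The difference is the
derivation with characteristic u^ρ_t + g^ρ, whose coefficients vanish on solutions. -/
theorem D_none_eq (g : Fin N → DiffAlg U) (f : DiffAlg U) :
    D none f = solD g f + ∑ ρ, Op (coordT ρ + g ρ) (gradAt ρ f) := by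
  simp only [Op_add_left, Finset.sum_add_distrib]
  rw [sum_Op_gradAt, D, vf_apply, solD]
  have : (fun c : JetIdx n N => (coordU (shift none c) : DiffAlg U))
      = fun c => DD c.2 (coordT c.1) := funext fun c => by
    rw [coordT, DD_coordU, shift, add_comm]
    rfl
  rw [this]
  ring

theorem Adj_single_unit_none (V : DiffAlg U) :
    Adj V (Finsupp.single ((1, 0) : MIdx n) 1) = -D none V := by
  rw [Adj_single, one_mul, show ((1, 0) : MIdx n) = unitIdx none from rfl, DD_unitIdx, sgn_unit,
    neg_one_smul]
  rfl

/-- The Euler operator applied to `∑_ρ (u^ρ_t + g^ρ) Λ_ρ`. -/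
theorem Eul_sum_mul (g Λ : Fin N → DiffAlg U) (σ : Fin N) :
    Eul σ (∑ ρ, (coordT ρ + g ρ) * Λ ρ)
      = (-solD g (Λ σ) + ∑ ρ, Adj (Λ ρ) (gradAt σ (g ρ)))
        + ∑ ρ, Op (coordT ρ + g ρ) (adjCoef (gradAt σ (Λ ρ)) - gradAt ρ (Λ σ)) := by
  -- The factor u^σ_t contributes the adjoint of D_t. Splitting this D_t by `D_none_eq` produces
  -- both `solD` and the operators subtracted in the last sum.
  have h1 : ∑ ρ, Adj (Λ ρ) (gradAt σ (coordT ρ)) = -D none (Λ σ) := by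
    rw [Finset.sum_eq_single σ]
    · rw [coordT, gradAt_coordU, if_pos rfl, Adj_single_unit_none]
    · intro ρ _ hρ
      rw [coordT, gradAt_coordU, if_neg hρ, map_zero]
    · exact fun h => absurd (Finset.mem_univ _) h
  rw [map_sum]
  simp only [Eul_mul, map_add, map_sub, Op_adjCoef, Finset.sum_add_distrib,
    Finset.sum_sub_distrib]
  rw [h1, D_none_eq g]
  ring

/-- The Euler operator annihilates `∑_ρ (u^ρ_t + g^ρ) Λ_ρ` if and only if `Λ` is an adjoint symmetry
whose linearization is formally self-adjoint. -/
theorem Eul_sum_mul_eq_zero_iff {g Λ : Fin N → DiffAlg U} (hg : ∀ σ, g σ ∈ Spatial U)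
    (hΛ : ∀ σ, Λ σ ∈ Spatial U) :
    (∀ σ, Eul σ (∑ ρ, (coordT ρ + g ρ) * Λ ρ) = 0) ↔
      (∀ σ, -solD g (Λ σ) + ∑ ρ, Adj (Λ ρ) (gradAt σ (g ρ)) = 0) ∧
        ∀ σ ρ, gradAt ρ (Λ σ) = adjCoef (gradAt σ (Λ ρ)) := by
  constructor
  · intro h
    have hC : ∀ σ ρ, gradAt ρ (Λ σ) = adjCoef (gradAt σ (Λ ρ)) := by
      intro σ τ
      have hS : ∀ ρ q, (adjCoef (gradAt σ (Λ ρ)) - gradAt ρ (Λ σ)) q ∈ Spatial U := fun ρ q =>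
        Subalgebra.sub_mem _ (adjCoef_mem_spatial (hΛ ρ) σ q) (pd_mem_spatial (hΛ σ) _)
      have hS0 : ∀ ρ, ∀ q : MIdx n, q.1 ≠ 0 →
          (adjCoef (gradAt σ (Λ ρ)) - gradAt ρ (Λ σ)) q = 0 := fun ρ q hq => by
        rw [Finsupp.sub_apply, adjCoef_eq_zero (hΛ ρ) hq, gradAt_apply, hΛ σ (ρ, q) hq, sub_zero]
      have hA : -solD g (Λ σ) + ∑ ρ, Adj (Λ ρ) (gradAt σ (g ρ)) ∈ Spatial U :=
        Subalgebra.add_mem _ (Subalgebra.neg_mem _ (Subalgebra.sub_mem _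
          (pd_mem_spatial (hΛ σ) _) (Subalgebra.sum_mem _ fun ρ _ => Op_mem_spatial (hg ρ)
            (fun q => pd_mem_spatial (hΛ σ) _) fun q hq => hΛ σ (ρ, q) hq)))
          (Subalgebra.sum_mem _ fun ρ _ => Adj_mem_spatial (hg ρ) (hΛ ρ) σ)
      symm
      rw [← sub_eq_zero]
      ext1 q
      -- Differentiation with respect to u^τ_{(1,0)+q} kills the adjoint-symmetry part and all terms
      -- with `g`, which are spatial. What is left is the q-th coefficient of the operator applied
      -- to u^τ_t.
      have hne : ((τ, ((1, 0) : MIdx n) + q) : JetIdx n N).2.1 ≠ 0 := by simp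
      have h1 := congrArg (pd (dirU (τ, ((1, 0) : MIdx n) + q))) (h σ)
      rw [Eul_sum_mul, map_add, hA _ hne, zero_add, map_sum, map_zero] at h1
      refine Eq.trans ?_ h1
      rw [Finset.sum_eq_single τ]
      · rw [Op_add_left, map_add, Op_mem_spatial (hg τ) (hS τ) (hS0 τ) _ hne, add_zero, coordT,
          pd_Op_coordU fun s => hS τ s _ hne, if_pos rfl]
      · intro ρ _ hρ
        rw [Op_add_left, map_add, Op_mem_spatial (hg ρ) (hS ρ) (hS0 ρ) _ hne, add_zero, coordT,
          pd_Op_coordU fun s => hS ρ s _ hne, if_neg hρ]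
      · exact fun h => absurd (Finset.mem_univ _) h
    refine ⟨fun σ => ?_, hC⟩
    have h1 := h σ
    rw [Eul_sum_mul] at h1
    simpa only [hC σ, sub_self, map_zero, Finset.sum_const_zero, add_zero] using h1
  · rintro ⟨h1, h2⟩ σ
    rw [Eul_sum_mul, h1, zero_add]
    exact Finset.sum_eq_zero fun ρ _ => by rw [h2 σ ρ, sub_self, map_zero]

end Spatial

/-! ### From functions on jet space to elements of the algebra -/

section Representation

open Topology TopologicalSpace

variable {U : Opens (Jet n N)}

/-- Evaluation at a point. -/
def evalAt (z : U) : DiffAlg U →ₐ[ℝ] ℝ :=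
  (Pi.evalAlgHom ℝ (fun _ : U => ℝ) z).comp (diffSubalgebra U).val

theorem evalAt_apply (z : U) (f : DiffAlg U) : evalAt z f = (f : U → ℝ) z := rfl

/-- `f` is the restriction of `F` to `U`. -/
def Rep (F : Jet n N → ℝ) (f : DiffAlg U) : Prop := ∀ z : U, F z = (f : U → ℝ) z

theorem isDiffFun_iff {F : Jet n N → ℝ} : IsDiffFun U F ↔ ∃ f : DiffAlg U, Rep F f := by
  constructor
  · rintro ⟨S, φ, hφ, hF⟩
    exact ⟨⟨fun z => F z, S, φ, hφ, fun z => hF z z.2⟩, fun _ => rfl⟩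
  · rintro ⟨f, hf⟩
    obtain ⟨S, φ, hφ, h⟩ := exists_isRep f
    exact ⟨S, φ, hφ, fun z hz => (hf ⟨z, hz⟩).trans (h ⟨z, hz⟩)⟩

theorem rep_extZ (f : DiffAlg U) : Rep (extZ (f : U → ℝ)) f := extZ_of_mem _

theorem Rep.isDiffFun {F : Jet n N → ℝ} {f : DiffAlg U} (h : Rep F f) : IsDiffFun U F :=
  isDiffFun_iff.2 ⟨f, h⟩

theorem Rep.deriv_line {F : Jet n N → ℝ} {f : DiffAlg U} (h : Rep F f) (z : U) (v : Jet n N) :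
    deriv (fun s : ℝ => F (z + s • v)) 0 = dirDeriv f z v := by
  refine Filter.EventuallyEq.deriv_eq ?_
  filter_upwards [eventually_line_mem z v] with s hs
  rw [h ⟨_, hs⟩, extZ_of_mem f ⟨_, hs⟩]

theorem Rep.partialT {F : Jet n N → ℝ} {f : DiffAlg U} (h : Rep F f) :
    Rep (partialT F) (pd (dirB (indepDir none)) f) := fun z => by
  rw [pd_apply, ← h.deriv_line, CauchyKovalevskaya.partialT,
    ← add_zero z.1.1, ← deriv_comp_const_add]
  congr 1
  ext s
  congr 1
  ext <;> simp [dirB, indepDir]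

theorem Rep.partialX {F : Jet n N → ℝ} {f : DiffAlg U} (h : Rep F f) (i : Fin n) :
    Rep (partialX i F) (pd (dirB (indepDir (some i))) f) := fun z => by
  rw [pd_apply, ← h.deriv_line, CauchyKovalevskaya.partialX,
    ← add_zero (z.1.2.1 i), ← deriv_comp_const_add]
  congr 1
  ext s
  congr 1
  ext j
  · simp [dirB, indepDir]
  · by_cases hj : j = i
    · subst hj; simp [dirB, indepDir]
    · simp [dirB, indepDir, hj]
  · simp [dirB, indepDir]

theorem Rep.partialU {F : Jet n N → ℝ} {f : DiffAlg U} (h : Rep F f) (c : JetIdx n N) :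
    Rep (partialU c F) (pd (dirU c) f) := fun z => by
  rw [pd_apply, ← h.deriv_line, CauchyKovalevskaya.partialU,
    ← add_zero (z.1.2.2 c), ← deriv_comp_const_add]
  congr 1
  ext s
  congr 1
  ext j
  · simp [dirU]
  · simp [dirU]
  · by_cases hj : j = c
    · subst hj; simp [dirU]
    · simp [dirU, hj]

theorem Rep.finsum_mul {F : Jet n N → ℝ} {f : DiffAlg U} (h : Rep F f)
    (a : JetIdx n N → DiffAlg U) (A : JetIdx n N → Jet n N → ℝ) (hA : ∀ c, Rep (A c) (a c)) :
    Rep (fun z => ∑ᶠ c, A c z * CauchyKovalevskaya.partialU c F z)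
      (Finsupp.linearCombination (DiffAlg U) a (grad f)) := fun z => by
  rw [← evalAt_apply, Finsupp.linearCombination_apply, Finsupp.sum, map_sum]
  beta_reduce
  rw [finsum_eq_sum_of_support_subset (s := (grad f).support)]
  · refine Finset.sum_congr rfl fun c _ => ?_
    rw [(h.partialU c) z, hA c z, smul_eq_mul, map_mul, mul_comm]
    rfl
  · intro c hc
    rw [Finset.mem_coe, Finsupp.mem_support_iff]
    intro h0
    refine hc ?_
    beta_reduce
    rw [(h.partialU c) z, ← grad_apply, h0]
    exact mul_zero _

theorem Rep.add {F G : Jet n N → ℝ} {f g : DiffAlg U} (hF : Rep F f) (hG : Rep G g) :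
    Rep (fun z => F z + G z) (f + g) := fun z => congrArg₂ (· + ·) (hF z) (hG z)

theorem Rep.mul {F G : Jet n N → ℝ} {f g : DiffAlg U} (hF : Rep F f) (hG : Rep G g) :
    Rep (fun z => F z * G z) (f * g) := fun z => congrArg₂ (· * ·) (hF z) (hG z)

theorem Rep.sum {ι : Type*} (s : Finset ι) {F : ι → Jet n N → ℝ} {f : ι → DiffAlg U}
    (h : ∀ i, Rep (F i) (f i)) : Rep (fun z => ∑ i ∈ s, F i z) (∑ i ∈ s, f i) := fun z => by
  rw [← evalAt_apply, map_sum]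
  exact Finset.sum_congr rfl fun i _ => h i z

theorem rep_coordU (c : JetIdx n N) : Rep (fun z => z.2.2 c) (coordU c : DiffAlg U) :=
  fun _ => rfl

theorem Rep.totalT {F : Jet n N → ℝ} {f : DiffAlg U} (h : Rep F f) :
    Rep (totalT F) (D none f) :=
  h.partialT.add (h.finsum_mul _ _ fun c => rep_coordU (shift none c))

theorem Rep.totalX {F : Jet n N → ℝ} {f : DiffAlg U} (h : Rep F f) (i : Fin n) :
    Rep (totalX i F) (D (some i) f) := by
  refine (h.partialX i).add (h.finsum_mul _ (fun c z => z.2.2 (c.1, c.2.1, c.2.2 + Pi.single i 1))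
    fun c => ?_)
  exact rep_coordU (shift (some i) c)

theorem Rep.totalXs {F : Jet n N → ℝ} {f : DiffAlg U} (h : Rep F f) (I : Fin n → ℕ) :
    Rep (totalXs I F) (DD (0, I) f) := by
  have key : ∀ l : List (Fin n),
      Rep (l.foldr (fun i G => (CauchyKovalevskaya.totalX i)^[I i] G) F)
        ((l.map fun i => De (some i) ^ I i).prod f) := by
    intro l
    induction l with
    | nil => exact h
    | cons i l ih =>
      rw [List.foldr_cons, List.map_cons, List.prod_cons, Module.End.mul_apply]
      generalize (l.map fun i => De (some i) ^ I i).prod f = g at ih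
      generalize l.foldr (fun i G => (CauchyKovalevskaya.totalX i)^[I i] G) F = G at ih
      induction I i with
      | zero => exact ih
      | succ k ihk =>
        rw [Function.iterate_succ_apply', pow_succ', Module.End.mul_apply]
        exact ihk.totalX i
  have h1 : DD (0, I) f = ((List.finRange n).map fun i => De (some i) ^ I i).prod f := by
    rw [DD, pow_zero, one_mul]
  rw [h1]
  exact key _

/-! ### Functions of the independent variables -/

theorem truncL_base_mem (S : Finset (JetIdx n N)) {y : ℝ × (Fin n → ℝ) × (S → ℝ)}
    (hy : y ∈ trunc S '' (U : Set (Jet n N))) : (y.1, y.2.1) ∈ base (U : Set (Jet n N)) := by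
  obtain ⟨z, hz, rfl⟩ := hy
  exact ⟨z, hz, rfl⟩

theorem base_mem (z : U) : (z.1.1, z.1.2.1) ∈ base (U : Set (Jet n N)) := ⟨z, z.2, rfl⟩

/-- A smooth function of the independent variables as a differential function. -/
def baseFn (w : ℝ × (Fin n → ℝ) → ℝ) (hw : ContDiffOn ℝ ∞ w (base (U : Set (Jet n N)))) :
    DiffAlg U :=
  ⟨fun z => w (z.1.1, z.1.2.1), ∅, fun y => w (y.1, y.2.1),
    hw.comp (ContDiff.contDiffOn (by fun_prop)) fun _ => truncL_base_mem ∅, fun _ => rfl⟩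

theorem rep_baseFn (w : ℝ × (Fin n → ℝ) → ℝ) (hw : ContDiffOn ℝ ∞ w (base (U : Set (Jet n N)))) :
    Rep (fun z => w (z.1, z.2.1)) (baseFn w hw : DiffAlg U) := fun _ => rfl

/-- With the fibre coordinates frozen at a point of `U` over the given base point, a representative
of `f` agrees with `w` nearby. -/
theorem contDiffOn_of_rep {w : ℝ × (Fin n → ℝ) → ℝ} {f : DiffAlg U}
    (h : Rep (fun z => w (z.1, z.2.1)) f) : ContDiffOn ℝ ∞ w (base (U : Set (Jet n N))) := by
  rintro _ ⟨z, hz, rfl⟩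
  refine ContDiffAt.contDiffWithinAt ?_
  obtain ⟨S, φ, hφ⟩ := exists_isRep f
  have h1 : ContDiffAt ℝ ∞ (fun a : ℝ × (Fin n → ℝ) => φ (a.1, a.2, (trunc S z).2.2))
      (z.1, z.2.1) := by
    refine ContDiffAt.comp (z.1, z.2.1) (g := φ) (hφ.contDiffAt ⟨z, hz⟩) (by fun_prop)
  refine h1.congr_of_eventuallyEq ?_
  have h2 : ContinuousAt (fun a : ℝ × (Fin n → ℝ) => ((a.1, a.2, z.2.2) : Jet n N))
      (z.1, z.2.1) := by fun_prop
  filter_upwards [h2.eventually_mem (U.2.mem_nhds hz)] with a ha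
  exact (h ⟨_, ha⟩).trans (hφ.2 ⟨_, ha⟩)

theorem partialU_base (w : ℝ × (Fin n → ℝ) → ℝ) (c : JetIdx n N) (z : Jet n N) :
    partialU c (fun z => w (z.1, z.2.1)) z = 0 := deriv_const (z.2.2 c) (w (z.1, z.2.1))

theorem rep_derivT {w : ℝ × (Fin n → ℝ) → ℝ} {f : DiffAlg U}
    (h : Rep (fun z => w (z.1, z.2.1)) f) :
    Rep (fun z => derivT w (z.1, z.2.1)) (D none f) := fun z => by
  rw [← h.totalT z, totalT]
  simp only [partialU_base, mul_zero, finsum_zero, add_zero]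
  rfl

theorem rep_derivX {w : ℝ × (Fin n → ℝ) → ℝ} {f : DiffAlg U}
    (h : Rep (fun z => w (z.1, z.2.1)) f) (i : Fin n) :
    Rep (fun z => derivX i w (z.1, z.2.1)) (D (some i) f) := fun z => by
  rw [← h.totalX i z, totalX]
  simp only [partialU_base, mul_zero, finsum_zero, add_zero]
  rfl

/-- On functions of (t, x) total derivatives are ordinary partial derivatives. The jet of `v` thus
inherits smoothness and independence of the order of differentiation from `DD`. -/
theorem rep_jetOf {v : Fin N → ℝ × (Fin n → ℝ) → ℝ} {f : Fin N → DiffAlg U}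
    (h : ∀ σ, Rep (fun z => v σ (z.1, z.2.1)) (f σ)) (c : JetIdx n N) :
    Rep (fun z => jetOf v (z.1, z.2.1) c) (DD c.2 (f c.1)) := by
  have hX : ∀ l : List (Fin n),
      Rep (fun z => (l.foldr (fun i w => (derivX i)^[c.2.2 i] w) (v c.1)) (z.1, z.2.1))
        ((l.map fun i => De (some i) ^ c.2.2 i).prod (f c.1)) := by
    intro l
    induction l with
    | nil => exact h c.1
    | cons i l ih =>
      rw [List.foldr_cons, List.map_cons, List.prod_cons, Module.End.mul_apply]
      generalize (l.map fun i => De (some i) ^ c.2.2 i).prod (f c.1) = g at ih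
      generalize l.foldr (fun i w => (derivX i)^[c.2.2 i] w) (v c.1) = G at ih
      induction c.2.2 i with
      | zero => exact ih
      | succ k ihk =>
        rw [Function.iterate_succ_apply', pow_succ', Module.End.mul_apply]
        exact rep_derivX ihk i
  have hX' := hX (List.finRange n)
  rw [DD, Module.End.mul_apply]
  simp only [jetOf]
  generalize ((List.finRange n).map fun i => De (some i) ^ c.2.2 i).prod (f c.1) = g at hX'
  generalize (List.finRange n).foldr (fun i w => (derivX i)^[c.2.2 i] w) (v c.1) = G at hX'
  induction c.2.1 with
  | zero => exact hX'
  | succ k ihk =>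
    rw [pow_succ', Module.End.mul_apply, Function.iterate_succ']
    exact rep_derivT ihk

/-- The direction in jet space along which the total derivative is taken. -/
def totalDir (i : Option (Fin n)) (z : Jet n N) : Jet n N :=
  ((indepDir i).1, (indepDir i).2, fun c => z.2.2 (shift i c))

/-- A representative sees only finitely many components of `v`, so the splitting into coordinate
directions holds even if infinitely many components are nonzero. -/
theorem dirDeriv_eq_sum (f : DiffAlg U) (z : U) (v : Jet n N) :
    dirDeriv f z v = dirDeriv f z (dirB (v.1, v.2.1))
      + ∑ c ∈ (grad f).support, (grad f c : U → ℝ) z * v.2.2 c := by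
  classical
  obtain ⟨S, φ, hf⟩ := exists_isRep f
  have h1 : ∑ c ∈ (grad f).support, (grad f c : U → ℝ) z * v.2.2 c
      = ∑ c ∈ S, (grad f c : U → ℝ) z * v.2.2 c := by
    refine Finset.sum_subset hf.grad_support_subset fun c _ hc => ?_
    rw [Finsupp.notMem_support_iff.1 hc]
    exact zero_mul _
  have h2 : trunc S v = trunc S (dirB (v.1, v.2.1)) + ∑ c ∈ S, v.2.2 c • trunc S (dirU c) := by
    simp only [← truncL_apply, ← map_smul, ← map_sum, ← map_add]
    simp only [truncL_apply, trunc]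
    ext d
    · simp [dirB, dirU, Prod.fst_sum]
    · simp [dirB, dirU, Prod.fst_sum, Prod.snd_sum]
    · simp [dirB, dirU, Prod.snd_sum, Finset.sum_apply, Pi.single_apply]
  rw [h1, hf.dirDeriv_eq, hf.dirDeriv_eq, h2, map_add, map_sum]
  congr 1
  refine Finset.sum_congr rfl fun c _ => ?_
  rw [map_smul, smul_eq_mul, mul_comm, grad_apply, pd_apply, hf.dirDeriv_eq]

/-- Pointwise, a total derivative is a directional derivative; in this form the chain rule applies
to the contraction. -/
theorem D_apply_eq_dirDeriv (i : Option (Fin n)) (f : DiffAlg U) (z : U) :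
    (D i f : U → ℝ) z = dirDeriv f z (totalDir i z) := by
  rw [dirDeriv_eq_sum, D, vf_apply, ← evalAt_apply, map_add, Finsupp.linearCombination_apply,
    Finsupp.sum, map_sum]
  refine congrArg₂ _ rfl (Finset.sum_congr rfl fun c _ => ?_)
  rw [smul_eq_mul, map_mul]
  rfl

theorem D_baseFn_apply (i : Option (Fin n)) (w : ℝ × (Fin n → ℝ) → ℝ)
    (hw : ContDiffOn ℝ ∞ w (base (U : Set (Jet n N)))) (z : U) :
    (D i (baseFn w hw : DiffAlg U) : U → ℝ) z = fderiv ℝ w (z.1.1, z.1.2.1) (indepDir i) := by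
  rw [D_apply_eq_dirDeriv, ← (rep_baseFn w hw).deriv_line]
  have h1 : HasFDerivAt w (fderiv ℝ w (z.1.1, z.1.2.1)) ((z.1.1, z.1.2.1) + (0 : ℝ) • indepDir i) := by
    rw [zero_smul, add_zero]
    exact ((hw.contDiffAt ((isOpen_base U.2).mem_nhds (base_mem z))).differentiableAt
      (by simp)).hasFDerivAt
  have h2 : HasDerivAt (fun s : ℝ => (z.1.1, z.1.2.1) + s • indepDir i) (indepDir i) 0 := by
    simpa using ((hasDerivAt_id (0 : ℝ)).smul_const (indepDir i)).const_add (z.1.1, z.1.2.1)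
  exact (h1.comp_hasDerivAt 0 h2).deriv

end Representation

/-! ### Contraction of the fibres and homotopy operators -/

section Homotopy

open Topology TopologicalSpace Set

variable {U : Opens (Jet n N)} {j : JetIdx n N → ℝ × (Fin n → ℝ) → ℝ}

/-- The fibrewise contraction of jet space towards `j`. -/
def contraction (j : JetIdx n N → ℝ × (Fin n → ℝ) → ℝ) (s : ℝ) (z : Jet n N) : Jet n N :=
  (z.1, z.2.1, fun c => j c (z.1, z.2.1) + s * (z.2.2 c - j c (z.1, z.2.1)))

/-- The contraction in finitely many jet coordinates. -/
def contractionFin (j : JetIdx n N → ℝ × (Fin n → ℝ) → ℝ) (S : Finset (JetIdx n N))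
    (q : ℝ × ℝ × (Fin n → ℝ) × (S → ℝ)) : ℝ × (Fin n → ℝ) × (S → ℝ) :=
  (q.2.1, q.2.2.1,
    fun c => j c (q.2.1, q.2.2.1) + q.1 * (q.2.2.2 c - j c (q.2.1, q.2.2.1)))

theorem trunc_contraction (S : Finset (JetIdx n N)) (s : ℝ) (z : Jet n N) :
    trunc S (contraction j s z) = contractionFin j S (s, trunc S z) := rfl

/-- `U` is mapped to itself by the fibrewise contraction towards a smooth `j`. -/
structure IsCenter (U : Opens (Jet n N)) (j : JetIdx n N → ℝ × (Fin n → ℝ) → ℝ) : Prop where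
  smooth : ∀ c, ContDiffOn ℝ ∞ (j c) (base (U : Set (Jet n N)))
  mem : ∀ s ∈ Icc (0 : ℝ) 1, ∀ z ∈ U, contraction j s z ∈ U

/-- The contraction as a map of `U`, extended by a constant to parameters outside `[0, 1]`. -/
def IsCenter.step (hj : IsCenter U j) (s : ℝ) (z : U) : U :=
  ⟨contraction j (projIcc 0 1 zero_le_one s) z, hj.mem _ (Subtype.prop _) z z.2⟩

theorem IsCenter.step_coe (hj : IsCenter U j) {s : ℝ} (hs : s ∈ Icc (0 : ℝ) 1) (z : U) :
    (hj.step s z : Jet n N) = contraction j s z := by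
  simp only [IsCenter.step, projIcc_of_mem zero_le_one hs]

theorem contDiffOn_contractionFin (hj : IsCenter U j) (S : Finset (JetIdx n N)) :
    ContDiffOn ℝ ∞ (contractionFin j S) {q | q.2 ∈ trunc S '' (U : Set (Jet n N))} := by
  have hjc : ∀ c : S, ContDiffOn ℝ ∞ (fun q : ℝ × ℝ × (Fin n → ℝ) × (S → ℝ) =>
      j c (q.2.1, q.2.2.1)) {q | q.2 ∈ trunc S '' (U : Set (Jet n N))} := fun c =>
    (hj.smooth c).comp (ContDiff.contDiffOn (by fun_prop)) fun q hq => truncL_base_mem S hq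
  refine ContDiffOn.prodMk (ContDiff.contDiffOn (by fun_prop))
    (ContDiffOn.prodMk (ContDiff.contDiffOn (by fun_prop)) (contDiffOn_pi.2 fun c => ?_))
  exact (hjc c).add ((ContDiff.contDiffOn (by fun_prop)).mul
    ((ContDiff.contDiffOn (by fun_prop)).sub (hjc c)))

/-- The parameters and truncated jets which the contraction maps into the truncation of `U`. -/
def contractionDom (U : Opens (Jet n N)) (j : JetIdx n N → ℝ × (Fin n → ℝ) → ℝ)
    (S : Finset (JetIdx n N)) : Set (ℝ × ℝ × (Fin n → ℝ) × (S → ℝ)) :=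
  {q | q.2 ∈ trunc S '' (U : Set (Jet n N))} ∩
    contractionFin j S ⁻¹' (trunc S '' (U : Set (Jet n N)))

/-- Differentiation under the integral sign needs an open domain around the closed parameter
interval, so all parameters that keep the truncated jet inside are admitted. -/
theorem isOpen_contractionDom (hj : IsCenter U j) (S : Finset (JetIdx n N)) :
    IsOpen (contractionDom U j S) :=
  (contDiffOn_contractionFin hj S).continuousOn.isOpen_inter_preimage
    ((isOpenMap_trunc S _ U.2).preimage continuous_snd) (isOpenMap_trunc S _ U.2)

theorem mem_contractionDom (hj : IsCenter U j) (S : Finset (JetIdx n N))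
    {y : ℝ × (Fin n → ℝ) × (S → ℝ)} (hy : y ∈ trunc S '' (U : Set (Jet n N))) {s : ℝ}
    (hs : s ∈ Icc (0 : ℝ) 1) : (s, y) ∈ contractionDom U j S := by
  obtain ⟨z, hz, rfl⟩ := hy
  exact ⟨⟨z, hz, rfl⟩, ⟨_, hj.mem s hs z hz, rfl⟩⟩

/-- The integrand of the homotopy operator. -/
def integrand (j : JetIdx n N → ℝ × (Fin n → ℝ) → ℝ) (S : Finset (JetIdx n N)) (k : ℕ)
    (φ : ℝ × (Fin n → ℝ) × (S → ℝ) → ℝ) (q : ℝ × ℝ × (Fin n → ℝ) × (S → ℝ)) : ℝ :=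
  q.1 ^ k * φ (contractionFin j S q)

theorem contDiffOn_integrand (hj : IsCenter U j) {S : Finset (JetIdx n N)} (k : ℕ)
    {φ : ℝ × (Fin n → ℝ) × (S → ℝ) → ℝ} {f : U → ℝ} (hf : IsRep U S φ f) :
    ContDiffOn ℝ ∞ (integrand j S k φ) (contractionDom U j S) :=
  (ContDiff.contDiffOn (by fun_prop)).mul (hf.1.comp
    ((contDiffOn_contractionFin hj S).mono inter_subset_left) fun _ hq => hq.2)

theorem integrand_eq (hj : IsCenter U j) {S : Finset (JetIdx n N)} (k : ℕ)
    {φ : ℝ × (Fin n → ℝ) × (S → ℝ) → ℝ} {f : U → ℝ} (hf : IsRep U S φ f) {s : ℝ}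
    (hs : s ∈ Icc (0 : ℝ) 1) (z : U) :
    integrand j S k φ (s, trunc S z) = s ^ k * f (hj.step s z) := by
  rw [hf.2, hj.step_coe hs, trunc_contraction]
  rfl

theorem intervalIntegrable_homotopy (hj : IsCenter U j) (k : ℕ) (f : DiffAlg U) (z : U) :
    IntervalIntegrable (fun s => s ^ k * (f : U → ℝ) (hj.step s z)) MeasureTheory.volume 0 1 := by
  obtain ⟨S, φ, hf⟩ := exists_isRep f
  refine (intervalIntegrable_congr fun s hs => ?_).1 (intervalIntegrable_slice
    (contDiffOn_integrand hj k hf).continuousOn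
    fun s hs => mem_contractionDom hj S ⟨z, z.2, rfl⟩ hs)
  rw [uIoc_of_le zero_le_one] at hs
  exact integrand_eq hj k hf (Ioc_subset_Icc_self hs) z

theorem isRep_homotopy (hj : IsCenter U j) {S : Finset (JetIdx n N)} (k : ℕ)
    {φ : ℝ × (Fin n → ℝ) × (S → ℝ) → ℝ} {f : U → ℝ} (hf : IsRep U S φ f) :
    IsRep U S (fun y => ∫ s in (0 : ℝ)..1, integrand j S k φ (s, y))
      (fun z => ∫ s in (0 : ℝ)..1, s ^ k * f (hj.step s z)) := by
  refine ⟨contDiffOn_integral_slice (isOpen_contractionDom hj S) (isOpenMap_trunc S _ U.2)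
    (contDiffOn_integrand hj k hf) fun y hy s hs => mem_contractionDom hj S hy hs, fun z => ?_⟩
  refine intervalIntegral.integral_congr fun s hs => ?_
  rw [uIcc_of_le zero_le_one] at hs
  exact (integrand_eq hj k hf hs z).symm

/-- The homotopy operator `f ↦ ∫_0^1 s^k f(h_s) ds` along the contraction `h`. -/
def homotopy (hj : IsCenter U j) (k : ℕ) : DiffAlg U →ₗ[ℝ] DiffAlg U where
  toFun f := ⟨fun z => ∫ s in (0 : ℝ)..1, s ^ k * (f : U → ℝ) (hj.step s z), by
    obtain ⟨S, φ, hf⟩ := exists_isRep f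
    exact ⟨S, _, isRep_homotopy hj k hf⟩⟩
  map_add' f g := by
    ext z
    simp only [DiffAlg.coe_add, Pi.add_apply, mul_add]
    exact intervalIntegral.integral_add (intervalIntegrable_homotopy hj k f z)
      (intervalIntegrable_homotopy hj k g z)
  map_smul' r f := by
    ext z
    refine Eq.trans ?_ (intervalIntegral.integral_const_mul r _)
    refine intervalIntegral.integral_congr fun s _ => ?_
    simp only [DiffAlg.coe_smul, Pi.smul_apply, smul_eq_mul]
    ring

theorem homotopy_apply (hj : IsCenter U j) (k : ℕ) (f : DiffAlg U) (z : U) :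
    (homotopy hj k f : U → ℝ) z = ∫ s in (0 : ℝ)..1, s ^ k * (f : U → ℝ) (hj.step s z) := rfl

/-- The differential of the contraction. -/
def contractionDir (j : JetIdx n N → ℝ × (Fin n → ℝ) → ℝ) (s : ℝ) (z v : Jet n N) : Jet n N :=
  (v.1, v.2.1, fun c => fderiv ℝ (j c) (z.1, z.2.1) (v.1, v.2.1)
    + s * (v.2.2 c - fderiv ℝ (j c) (z.1, z.2.1) (v.1, v.2.1)))

theorem hasDerivAt_contractionFin (hj : IsCenter U j) (S : Finset (JetIdx n N)) (s : ℝ) (z : U)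
    (v : Jet n N) :
    HasDerivAt (fun τ : ℝ => contractionFin j S (s, trunc S z + τ • trunc S v))
      (trunc S (contractionDir j s z v)) 0 := by
  have hlin : ∀ a b : ℝ, HasDerivAt (fun τ : ℝ => a + τ • b) b 0 := fun a b => by
    simpa using ((hasDerivAt_id (0 : ℝ)).mul_const b).const_add a
  have hx : HasDerivAt (fun τ : ℝ => z.1.2.1 + τ • v.2.1) v.2.1 0 := by
    simpa using ((hasDerivAt_id (0 : ℝ)).smul_const v.2.1).const_add z.1.2.1
  have hb : HasDerivAt (fun τ : ℝ => (z.1.1 + τ • v.1, z.1.2.1 + τ • v.2.1)) (v.1, v.2.1) 0 :=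
    (hlin _ _).prodMk hx
  have hjc : ∀ c : JetIdx n N, HasDerivAt (fun τ : ℝ => j c (z.1.1 + τ • v.1, z.1.2.1 + τ • v.2.1))
      (fderiv ℝ (j c) (z.1.1, z.1.2.1) (v.1, v.2.1)) 0 := by
    intro c
    have h1 : HasFDerivAt (j c) (fderiv ℝ (j c) (z.1.1, z.1.2.1))
        (z.1.1 + (0 : ℝ) • v.1, z.1.2.1 + (0 : ℝ) • v.2.1) := by
      rw [zero_smul, zero_smul, add_zero, add_zero]
      exact (((hj.smooth c).contDiffAt ((isOpen_base U.2).mem_nhds (base_mem z))).differentiableAt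
        (by simp)).hasFDerivAt
    exact h1.comp_hasDerivAt 0 hb
  refine (hlin _ _).prodMk (hx.prodMk (hasDerivAt_pi.2 fun c => ?_))
  exact (hjc c).add (((hlin _ _).sub (hjc c)).const_mul s)

theorem dirDeriv_homotopy (hj : IsCenter U j) (k : ℕ) (f : DiffAlg U) (z : U) (v : Jet n N) :
    dirDeriv (homotopy hj k f) z v
      = ∫ s in (0 : ℝ)..1, s ^ k * dirDeriv f (hj.step s z) (contractionDir j s z v) := by
  obtain ⟨S, φ, hf⟩ := exists_isRep f
  have hz : trunc S z ∈ trunc S '' (U : Set (Jet n N)) := ⟨z, z.2, rfl⟩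
  have hW := isOpen_contractionDom hj S
  have hG := contDiffOn_integrand hj k hf
  have hint : IntervalIntegrable (fun s => (fderiv ℝ (integrand j S k φ) (s, trunc S z)).comp
      (ContinuousLinearMap.inr ℝ ℝ _)) MeasureTheory.volume 0 1 :=
    intervalIntegrable_slice (contDiffOn_fderiv_comp_inr hW hG).continuousOn
      fun s hs => mem_contractionDom hj S hz hs
  refine ((isRep_homotopy hj k hf).dirDeriv_eq z v).trans ?_
  rw [(hasFDerivAt_integral_slice hW hG fun s hs => mem_contractionDom hj S hz hs).fderiv,
    ContinuousLinearMap.intervalIntegral_apply hint]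
  refine intervalIntegral.integral_congr fun s hs => ?_
  rw [uIcc_of_le zero_le_one] at hs
  have hmem := mem_contractionDom hj S hz hs
  have h1 : HasFDerivAt (integrand j S k φ) (fderiv ℝ (integrand j S k φ) (s, trunc S z))
      (s, trunc S z + (0 : ℝ) • trunc S v) := by
    rw [zero_smul, add_zero]
    exact ((hG.contDiffAt (hW.mem_nhds hmem)).differentiableAt (by simp)).hasFDerivAt
  have h2 : HasDerivAt (fun τ : ℝ => (s, trunc S (z : Jet n N) + τ • trunc S v)) (0, trunc S v) 0 := by
    refine (hasDerivAt_const _ _).prodMk ?_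
    simpa using ((hasDerivAt_id (0 : ℝ)).smul_const (trunc S v)).const_add (trunc S (z : Jet n N))
  have h3 : HasFDerivAt φ (fderiv ℝ φ (trunc S (hj.step s z)))
      (contractionFin j S (s, trunc S z + (0 : ℝ) • trunc S v)) := by
    rw [zero_smul, add_zero, ← trunc_contraction, ← hj.step_coe hs]
    exact ((hf.contDiffAt _).differentiableAt (by simp)).hasFDerivAt
  have h4 := (h3.comp_hasDerivAt 0 (hasDerivAt_contractionFin hj S s z v)).const_mul (s ^ k)
  rw [hf.dirDeriv_eq]
  -- `h4` and `h5` differentiate the integrand along the same line, once through the contraction and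
  -- once directly.
  have h5 := h1.comp_hasDerivAt 0 h2
  exact h5.unique h4

/-- The contraction scales fibre directions by s, so each fibre derivative raises the power of s by
one. -/
theorem pd_dirU_homotopy (hj : IsCenter U j) (k : ℕ) (c : JetIdx n N) (f : DiffAlg U) :
    pd (dirU c) (homotopy hj k f) = homotopy hj (k + 1) (pd (dirU c) f) := by
  ext z
  rw [pd_apply, dirDeriv_homotopy, homotopy_apply]
  refine intervalIntegral.integral_congr fun s _ => ?_
  have h : contractionDir j s z (dirU c) = s • dirU c := by
    have h0 : (((0 : ℝ), (0 : Fin n → ℝ)) : ℝ × (Fin n → ℝ)) = 0 := rfl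
    simp only [contractionDir, dirU, h0, map_zero, zero_add, sub_zero]
    ext d <;> simp
  rw [h, dirDeriv_smul_right, pd_apply, pow_succ, mul_assoc]

/-- By `hjet` the centre is closed under total differentiation, so the differential of the
contraction carries `totalDir i z` to `totalDir` at the contracted point. -/
theorem D_homotopy (hj : IsCenter U j) (hjet : ∀ i c, ∀ a ∈ base (U : Set (Jet n N)),
      fderiv ℝ (j c) a (indepDir i) = j (shift i c) a)
    (k : ℕ) (i : Option (Fin n)) (f : DiffAlg U) :
    D i (homotopy hj k f) = homotopy hj k (D i f) := by
  ext z
  rw [D_apply_eq_dirDeriv, dirDeriv_homotopy, homotopy_apply]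
  refine intervalIntegral.integral_congr fun s hs => ?_
  rw [uIcc_of_le zero_le_one] at hs
  rw [D_apply_eq_dirDeriv]
  congr 2
  rw [hj.step_coe hs]
  simp only [contractionDir, totalDir, contraction, hjet i _ _ (base_mem z)]

theorem DD_homotopy (hj : IsCenter U j) (hjet : ∀ i c, ∀ a ∈ base (U : Set (Jet n N)),
      fderiv ℝ (j c) a (indepDir i) = j (shift i c) a)
    (k : ℕ) (q : MIdx n) (f : DiffAlg U) :
    DD q (homotopy hj k f) = homotopy hj k (DD q f) := by
  induction q using MIdx.induction with
  | zero => rw [DD_zero]; rfl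
  | add i q ih => rw [DD_unit_add, ih, D_homotopy hj hjet, DD_unit_add]

/-- The velocity of the contraction. -/
theorem hasDerivAt_comp_contraction (hj : IsCenter U j) {S : Finset (JetIdx n N)}
    {φ : ℝ × (Fin n → ℝ) × (S → ℝ) → ℝ} {f : DiffAlg U} (hf : IsRep U S φ f) (z : U) {s : ℝ}
    (hs : s ∈ Icc (0 : ℝ) 1) :
    HasDerivAt (fun s => φ (contractionFin j S (s, trunc S z)))
      (∑ c ∈ (grad f).support,
        (grad f c : U → ℝ) (hj.step s z) * (z.1.2.2 c - j c (z.1.1, z.1.2.1))) s := by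
  have h1 : HasFDerivAt φ (fderiv ℝ φ (trunc S (hj.step s z)))
      (contractionFin j S (s, trunc S z)) := by
    rw [← trunc_contraction, ← hj.step_coe hs]
    exact ((hf.contDiffAt _).differentiableAt (by simp)).hasFDerivAt
  have h2 : HasDerivAt (fun s => contractionFin j S (s, trunc S z))
      (trunc S (0, 0, fun c => z.1.2.2 c - j c (z.1.1, z.1.2.1))) s := by
    refine (hasDerivAt_const _ _).prodMk ((hasDerivAt_const _ _).prodMk (hasDerivAt_pi.2 fun c => ?_))
    have h : HasDerivAt (fun x => j c (z.1.1, z.1.2.1) + x * (z.1.2.2 c - j c (z.1.1, z.1.2.1)))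
        (z.1.2.2 c - j c (z.1.1, z.1.2.1)) s := by
      simpa using ((hasDerivAt_id s).mul_const (z.1.2.2 c - j c (z.1.1, z.1.2.1))).const_add
        (j c (z.1.1, z.1.2.1))
    exact h
  refine (h1.comp_hasDerivAt s h2).congr_deriv ?_
  rw [← hf.dirDeriv_eq, dirDeriv_eq_sum]
  have h0 : dirDeriv f (hj.step s z) (dirB ((0 : ℝ), (0 : Fin n → ℝ))) = 0 := by
    rw [← pd_apply, show (dirB ((0 : ℝ), (0 : Fin n → ℝ)) : Jet n N) = 0 from rfl, pd_zero]
    rfl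
  rw [h0, zero_add]

/-- The restriction of `f` to the centre, as a function of the independent variables. -/
theorem exists_center_restriction (hj : IsCenter U j) (f : DiffAlg U) :
    ∃ w : ℝ × (Fin n → ℝ) → ℝ, ContDiffOn ℝ ∞ w (base (U : Set (Jet n N))) ∧
      ∀ z : U, w (z.1.1, z.1.2.1) = (f : U → ℝ) (hj.step 0 z) := by
  obtain ⟨S, φ, hf⟩ := exists_isRep f
  refine ⟨fun a => φ (a.1, a.2, fun c => j c a), ?_, fun z => ?_⟩
  · refine hf.1.comp (contDiffOn_fst.prodMk (contDiffOn_snd.prodMk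
      (contDiffOn_pi.2 fun c => hj.smooth c))) ?_
    rintro _ ⟨z, hz, rfl⟩
    refine ⟨contraction j 0 z, hj.mem 0 (by simp) z hz, ?_⟩
    rw [trunc_contraction]
    simp [contractionFin, trunc]
  · rw [hf.2, hj.step_coe (by simp), trunc_contraction]
    simp [contractionFin, trunc]

/-- The coordinates relative to the centre. -/
def relCoord (hj : IsCenter U j) (c : JetIdx n N) : DiffAlg U :=
  coordU c - baseFn (j c) (hj.smooth c)

theorem relCoord_apply (hj : IsCenter U j) (c : JetIdx n N) (z : U) :
    (relCoord hj c : U → ℝ) z = z.1.2.2 c - j c (z.1.1, z.1.2.1) := rfl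

theorem step_one (hj : IsCenter U j) (z : U) : hj.step 1 z = z := by
  refine Subtype.ext ?_
  rw [hj.step_coe (by simp)]
  simp [contraction]

theorem linearCombination_relCoord_apply (hj : IsCenter U j) (k : ℕ) (f : DiffAlg U) (z : U) :
    (Finsupp.linearCombination (DiffAlg U) (relCoord hj)
      ((grad f).mapRange (homotopy hj k) (map_zero _)) : U → ℝ) z
      = ∫ s in (0 : ℝ)..1, s ^ k * ∑ c ∈ (grad f).support,
        (grad f c : U → ℝ) (hj.step s z) * (z.1.2.2 c - j c (z.1.1, z.1.2.1)) := by
  rw [linearCombination_eq_sum (S := (grad f).support) Finsupp.support_mapRange, ← evalAt_apply,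
    map_sum]
  simp only [Finset.mul_sum]
  rw [intervalIntegral.integral_finsetSum]
  · refine Finset.sum_congr rfl fun c _ => ?_
    rw [map_mul, evalAt_apply, evalAt_apply, relCoord_apply, Finsupp.mapRange_apply,
      homotopy_apply, ← intervalIntegral.integral_mul_const]
    congr 1
    ext s
    ring
  · intro c _
    have := (intervalIntegrable_homotopy hj k (grad f c) z).mul_const
      (z.1.2.2 c - j c (z.1.1, z.1.2.1))
    simpa only [mul_assoc] using this

theorem intervalIntegrable_velocity (hj : IsCenter U j) (k : ℕ) (f : DiffAlg U) (z : U) :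
    IntervalIntegrable (fun s => s ^ k * ∑ c ∈ (grad f).support,
        (grad f c : U → ℝ) (hj.step s z) * (z.1.2.2 c - j c (z.1.1, z.1.2.1)))
      MeasureTheory.volume 0 1 := by
  simp only [Finset.mul_sum]
  have h := IntervalIntegrable.sum (μ := MeasureTheory.volume) (a := 0) (b := 1)
    (grad f).support (f := fun c s => s ^ k * ((grad f c : U → ℝ) (hj.step s z)
      * (z.1.2.2 c - j c (z.1.1, z.1.2.1)))) (fun c _ => by
    have := (intervalIntegrable_homotopy hj k (grad f c) z).mul_const
      (z.1.2.2 c - j c (z.1.1, z.1.2.1))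
    simpa only [mul_assoc] using this)
  simpa only [Finset.sum_fn] using h

/-- The homotopy formula for `f(h_1) - f(h_0)`. -/
theorem sub_center_eq (hj : IsCenter U j) (f : DiffAlg U) (z : U) :
    (f : U → ℝ) z - (f : U → ℝ) (hj.step 0 z)
      = (Finsupp.linearCombination (DiffAlg U) (relCoord hj)
          ((grad f).mapRange (homotopy hj 0) (map_zero _)) : U → ℝ) z := by
  obtain ⟨S, φ, hf⟩ := exists_isRep f
  have hint := intervalIntegrable_velocity hj 0 f z
  simp only [pow_zero, one_mul] at hint
  rw [linearCombination_relCoord_apply]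
  simp only [pow_zero, one_mul]
  rw [intervalIntegral.integral_eq_sub_of_hasDerivAt (fun s hs => by
    rw [uIcc_of_le zero_le_one] at hs
    exact hasDerivAt_comp_contraction hj hf z hs) hint]
  rw [hf.2, hf.2, hj.step_coe (by simp), trunc_contraction]
  congr 2
  rw [← trunc_contraction, ← hj.step_coe (by simp), step_one]

/-- The homotopy formula for the derivative of `s f(h_s)`. -/
theorem eq_homotopy_add (hj : IsCenter U j) (f : DiffAlg U) :
    f = homotopy hj 0 f + Finsupp.linearCombination (DiffAlg U) (relCoord hj)
          ((grad f).mapRange (homotopy hj 1) (map_zero _)) := by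
  ext z
  obtain ⟨S, φ, hf⟩ := exists_isRep f
  have hint := intervalIntegrable_velocity hj 1 f z
  have hint0 := intervalIntegrable_homotopy hj 0 f z
  simp only [pow_zero, one_mul] at hint0
  simp only [pow_one] at hint
  rw [DiffAlg.coe_add, Pi.add_apply, linearCombination_relCoord_apply, homotopy_apply]
  simp only [pow_zero, one_mul, pow_one]
  rw [← intervalIntegral.integral_add hint0 hint]
  -- The factor s makes the primitive vanish at s = 0, so that, unlike in `sub_center_eq`, no value
  -- at the centre appears.
  have hd : ∀ s ∈ uIcc (0 : ℝ) 1,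
      HasDerivAt (fun s => s * φ (contractionFin j S (s, trunc S z)))
        ((f : U → ℝ) (hj.step s z) + s * ∑ c ∈ (grad f).support,
        (grad f c : U → ℝ) (hj.step s z) * (z.1.2.2 c - j c (z.1.1, z.1.2.1))) s := by
    intro s hs
    rw [uIcc_of_le zero_le_one] at hs
    refine ((hasDerivAt_id s).mul (hasDerivAt_comp_contraction hj hf z hs)).congr_deriv ?_
    rw [hf.2, hj.step_coe hs, trunc_contraction, one_mul]
    rfl
  rw [intervalIntegral.integral_eq_sub_of_hasDerivAt hd (hint0.add hint), one_mul, zero_mul,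
    sub_zero, ← trunc_contraction, ← hj.step_coe (by simp), step_one, hf.2]

end Homotopy

/-! ### Kernel of the Euler operator and the inverse problem -/

section Exactness

open Topology TopologicalSpace Set

variable {U : Opens (Jet n N)}

/-- The component of a point belonging to an independent variable. -/
def indepComp : Option (Fin n) → ℝ × (Fin n → ℝ) →L[ℝ] ℝ
  | none => ContinuousLinearMap.fst ℝ _ _
  | some i => (ContinuousLinearMap.proj i).comp (ContinuousLinearMap.snd ℝ _ _)

theorem indepComp_indepDir (i : Option (Fin n)) : indepComp i (indepDir i) = 1 := by
  cases i <;> simp [indepComp, indepDir]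

theorem sum_indepComp_smul (b : ℝ × (Fin n → ℝ)) : ∑ i, indepComp i b • indepDir i = b := by
  rw [Fintype.sum_option]
  ext k
  · simp [indepComp, indepDir, Prod.fst_sum]
  · simp [indepComp, indepDir, Prod.snd_sum, Finset.sum_apply, Pi.single_apply]

/-- Smooth functions on a star-shaped base are total divergences. -/
theorem baseFn_mem_range_divergence {a₀ : ℝ × (Fin n → ℝ)}
    (hstar : StarConvex ℝ a₀ (base (U : Set (Jet n N)))) (w : ℝ × (Fin n → ℝ) → ℝ)
    (hw : ContDiffOn ℝ ∞ w (base (U : Set (Jet n N)))) :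
    (baseFn w hw : DiffAlg U) ∈ LinearMap.range (divergence (U := U)) := by
  set B := base (U : Set (Jet n N)) with hB
  have hBo : IsOpen B := isOpen_base U.2
  set γ : ℝ × ℝ × (Fin n → ℝ) → ℝ × (Fin n → ℝ) := fun q => a₀ + q.1 • (q.2 - a₀) with hγ
  have hγc : ContDiff ℝ ∞ γ := by fun_prop
  have hW : IsOpen (γ ⁻¹' B) := hBo.preimage hγc.continuous
  have hmem : ∀ a ∈ B, ∀ s ∈ Icc (0 : ℝ) 1, (s, a) ∈ γ ⁻¹' B := fun a ha s hs =>
    hstar.add_smul_sub_mem ha hs.1 hs.2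
  -- The weight s^n fits n + 1 independent variables: the divergence of (a - a₀) ∫ s^n w(γ) ds
  -- collects n + 1 copies of the integral and, with one more s from the chain rule, the radial
  -- derivative. Together they are ∫ d/ds (s^(n+1) w(γ)) ds = w(a).
  set G : ℝ × ℝ × (Fin n → ℝ) → ℝ := fun q => q.1 ^ n * w (γ q) with hG
  have hGc : ContDiffOn ℝ ∞ G (γ ⁻¹' B) :=
    (ContDiff.contDiffOn (by fun_prop)).mul (hw.comp hγc.contDiffOn fun _ h => h)
  have hK : ContDiffOn ℝ ∞ (fun a => ∫ s in (0 : ℝ)..1, G (s, a)) B :=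
    contDiffOn_integral_slice hW hBo hGc hmem
  have hwd : ∀ {a}, a ∈ B → HasFDerivAt w (fderiv ℝ w a) a := fun ha =>
    ((hw.contDiffAt (hBo.mem_nhds ha)).differentiableAt (by simp)).hasFDerivAt
  have hKd : ∀ a ∈ B, fderiv ℝ (fun a => ∫ s in (0 : ℝ)..1, G (s, a)) a (a - a₀)
      = ∫ s in (0 : ℝ)..1, s ^ (n + 1) * fderiv ℝ w (γ (s, a)) (a - a₀) := by
    intro a ha
    rw [(hasFDerivAt_integral_slice hW hGc (hmem a ha)).fderiv,
      ContinuousLinearMap.intervalIntegral_apply (intervalIntegrable_slice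
        (contDiffOn_fderiv_comp_inr hW hGc).continuousOn (hmem a ha))]
    refine intervalIntegral.integral_congr fun s hs => ?_
    rw [uIcc_of_le zero_le_one] at hs
    have h1 : HasFDerivAt G (fderiv ℝ G (s, a)) (s, a) :=
      ((hGc.contDiffAt (hW.mem_nhds (hmem a ha s hs))).differentiableAt (by simp)).hasFDerivAt
    have h2 := h1.comp a (hasFDerivAt_prodMk_right (𝕜 := ℝ) s a)
    have h3 : HasFDerivAt (fun a => γ (s, a)) (s • ContinuousLinearMap.id ℝ _) a :=
      (((hasFDerivAt_id a).sub_const a₀).const_smul s).const_add a₀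
    have h4 := ((hwd (hmem a ha s hs)).comp a h3).const_mul (s ^ n)
    have h5 := congrArg (fun L => L (a - a₀)) (h2.unique h4)
    refine h5.trans ?_
    simp only [smul_apply, ContinuousLinearMap.comp_apply, map_smul,
      ContinuousLinearMap.id_apply, smul_eq_mul]
    ring
  have hwc : ContinuousOn (fun q => fderiv ℝ w (γ q)) (γ ⁻¹' B) :=
    (hw.fderiv_of_isOpen hBo (m := ∞) (by simp)).continuousOn.comp hγc.continuous.continuousOn
      fun _ h => h
  have hftc : ∀ a ∈ B, (n + 1) * (∫ s in (0 : ℝ)..1, G (s, a))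
      + ∫ s in (0 : ℝ)..1, s ^ (n + 1) * fderiv ℝ w (γ (s, a)) (a - a₀) = w a := by
    intro a ha
    have i1 : IntervalIntegrable (fun s => (n + 1) * G (s, a)) MeasureTheory.volume 0 1 :=
      (intervalIntegrable_slice hGc.continuousOn (hmem a ha)).const_mul _
    have i2 : IntervalIntegrable (fun s => s ^ (n + 1) * fderiv ℝ w (γ (s, a)) (a - a₀))
        MeasureTheory.volume 0 1 := by
      refine intervalIntegrable_slice (G := fun q : ℝ × ℝ × (Fin n → ℝ) =>
        q.1 ^ (n + 1) * fderiv ℝ w (γ q) (a - a₀)) ?_ (hmem a ha)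
      exact ContinuousOn.mul (Continuous.continuousOn (by fun_prop))
        (hwc.clm_apply continuousOn_const)
    rw [← intervalIntegral.integral_const_mul, ← intervalIntegral.integral_add i1 i2,
      intervalIntegral.integral_eq_sub_of_hasDerivAt (f := fun s => s ^ (n + 1) * w (γ (s, a)))
        (fun s hs => ?_) (i1.add i2)]
    · simp [hγ]
    · rw [uIcc_of_le zero_le_one] at hs
      have h3 : HasDerivAt (fun s => γ (s, a)) (a - a₀) s :=
        (((hasDerivAt_id s).smul_const (a - a₀)).const_add a₀).congr_deriv (one_smul _ _)
      refine ((hasDerivAt_pow (n + 1) s).mul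
        ((hwd (hmem a ha s hs)).comp_hasDerivAt s h3)).congr_deriv ?_
      simp only [hG]
      push_cast
      simp
      ring
  have hL : ∀ i, ContDiffOn ℝ ∞ (fun a => indepComp i (a - a₀)) B := fun i =>
    ContDiff.contDiffOn (by fun_prop)
  refine ⟨fun i => baseFn (fun a => indepComp i (a - a₀)) (hL i) * baseFn _ hK, ?_⟩
  ext z
  have hz := base_mem z
  rw [divergence_apply, ← evalAt_apply, map_sum]
  have hterm : ∀ i, evalAt z (D i (baseFn (fun a => indepComp i (a - a₀)) (hL i) * baseFn _ hK))
      = fderiv ℝ (fun a => ∫ s in (0 : ℝ)..1, G (s, a)) (z.1.1, z.1.2.1)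
          (indepComp i ((z.1.1, z.1.2.1) - a₀) • indepDir i)
        + ∫ s in (0 : ℝ)..1, G (s, (z.1.1, z.1.2.1)) := by
    intro i
    have h1 : fderiv ℝ (fun a => indepComp i (a - a₀)) (z.1.1, z.1.2.1) = indepComp i :=
      ((indepComp i).hasFDerivAt.comp _ ((hasFDerivAt_id _).sub_const a₀)).fderiv
    rw [Derivation.leibniz, map_add, smul_eq_mul, smul_eq_mul, map_mul, map_mul, evalAt_apply,
      evalAt_apply, evalAt_apply, evalAt_apply, D_baseFn_apply, D_baseFn_apply, h1,
      indepComp_indepDir, mul_one, map_smul, smul_eq_mul]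
    rfl
  rw [Finset.sum_congr rfl fun i _ => hterm i, Finset.sum_add_distrib, ← map_sum,
    sum_indepComp_smul, Finset.sum_const, hKd _ hz, Finset.card_univ, Fintype.card_option,
    Fintype.card_fin, nsmul_eq_mul, add_comm]
  push_cast
  exact hftc _ hz

variable {j : JetIdx n N → ℝ × (Fin n → ℝ) → ℝ}

/-- Both u_c and the centre satisfy D_i y_c = y_{c+i}, the latter by `hjet`; hence so does their
difference. -/
theorem relCoord_eq_DD (hj : IsCenter U j) (hjet : ∀ i c, ∀ a ∈ base (U : Set (Jet n N)),
      fderiv ℝ (j c) a (indepDir i) = j (shift i c) a) (c : JetIdx n N) :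
    relCoord hj c = DD c.2 (relCoord hj (c.1, 0)) := by
  obtain ⟨σ, q⟩ := c
  induction q using MIdx.induction with
  | zero => rw [DD_zero]; rfl
  | add i q ih =>
    have hD : D i (relCoord hj (σ, q))
        = coordU (shift i (σ, q)) - D i (baseFn (j (σ, q)) (hj.smooth (σ, q))) := by
      rw [relCoord, map_sub, D_coordU]
    have hs : shift i (σ, q) = (σ, unitIdx i + q) := by rw [shift, add_comm]
    rw [DD_unit_add, ← ih, hD]
    ext z
    rw [← evalAt_apply, ← evalAt_apply, map_sub, evalAt_apply, evalAt_apply, evalAt_apply,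
      D_baseFn_apply, hjet i _ _ (base_mem z), hs]
    rfl

theorem Adj_one_mapRange {L : DiffAlg U →ₗ[ℝ] DiffAlg U} (hL : ∀ q f, DD q (L f) = L (DD q f))
    (c : MIdx n →₀ DiffAlg U) : Adj 1 (c.mapRange L (map_zero _)) = L (Adj 1 c) := by
  induction c using Finsupp.induction_linear with
  | zero => rw [Finsupp.mapRange_zero, map_zero, map_zero]
  | add c d hc hd => rw [Finsupp.mapRange_add (map_add L), map_add, hc, hd, map_add, map_add]
  | single q a =>
    rw [Finsupp.mapRange_single, Adj_single, Adj_single, mul_one, mul_one, hL, map_smul]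

theorem adjCoef_mapRange {L : DiffAlg U →ₗ[ℝ] DiffAlg U} (hL : ∀ q f, DD q (L f) = L (DD q f))
    (c : MIdx n →₀ DiffAlg U) :
    adjCoef (c.mapRange L (map_zero _)) = (adjCoef c).mapRange L (map_zero _) := by
  induction c using Finsupp.induction_linear with
  | zero => rw [Finsupp.mapRange_zero, map_zero, Finsupp.mapRange_zero]
  | add c d hc hd =>
    rw [Finsupp.mapRange_add (map_add L), map_add, hc, hd, map_add,
      Finsupp.mapRange_add (map_add L)]
  | single q a =>
    ext1 r
    rw [Finsupp.mapRange_single, adjCoef_single, adjCoef_single, Finsupp.mapRange_apply,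
      Finsupp.finsetSum_apply, Finsupp.finsetSum_apply, map_sum]
    refine Finset.sum_congr rfl fun s _ => ?_
    rw [Finsupp.smul_apply, Finsupp.smul_apply, map_smul, hL, ← Finsupp.mapRange_single
      (hf := map_zero L), Finsupp.mapRange_apply]

theorem compAt_mapRange (L : DiffAlg U →ₗ[ℝ] DiffAlg U) (ρ : Fin N) (f : DiffAlg U) :
    compAt ρ ((grad f).mapRange L (map_zero _)) = (gradAt ρ f).mapRange L (map_zero _) := by
  ext1 q
  rfl

/-- The integrated velocity becomes a sum of differential operators acting on u^ρ - v^ρ, open to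
integration by parts and to self-adjointness. -/
theorem linearCombination_relCoord_eq (hj : IsCenter U j)
    (hjet : ∀ i c, ∀ a ∈ base (U : Set (Jet n N)),
      fderiv ℝ (j c) a (indepDir i) = j (shift i c) a)
    (L : DiffAlg U →ₗ[ℝ] DiffAlg U) (f : DiffAlg U) :
    Finsupp.linearCombination (DiffAlg U) (relCoord hj) ((grad f).mapRange L (map_zero _))
      = ∑ ρ, Op (relCoord hj (ρ, 0)) ((gradAt ρ f).mapRange L (map_zero _)) := by
  have h := sum_Op_compAt (fun ρ => relCoord hj (ρ, 0)) ((grad f).mapRange L (map_zero _))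
  simp only [compAt_mapRange, ← relCoord_eq_DD hj hjet] at h
  exact h.symm

/-- On a star-shaped domain, the kernel of the Euler operator consists of total divergences. -/
theorem mem_range_divergence_of_Eul_eq_zero (hj : IsCenter U j)
    (hjet : ∀ i c, ∀ a ∈ base (U : Set (Jet n N)),
      fderiv ℝ (j c) a (indepDir i) = j (shift i c) a)
    {a₀ : ℝ × (Fin n → ℝ)} (hstar : StarConvex ℝ a₀ (base (U : Set (Jet n N))))
    {f : DiffAlg U} (hf : ∀ σ, Eul σ f = 0) : f ∈ LinearMap.range (divergence (U := U)) := by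
  obtain ⟨w, hw, hwf⟩ := exists_center_restriction hj f
  have hsub : f = Finsupp.linearCombination (DiffAlg U) (relCoord hj)
      ((grad f).mapRange (homotopy hj 0) (map_zero _)) + baseFn w hw := by
    ext z
    rw [DiffAlg.coe_add, Pi.add_apply, ← sub_center_eq]
    have : (baseFn w hw : DiffAlg U).toFun z = f.toFun (hj.step 0 z) := hwf z
    rw [this, sub_add_cancel]
  rw [hsub]
  refine Submodule.add_mem _ ?_ (baseFn_mem_range_divergence hstar w hw)
  rw [linearCombination_relCoord_eq hj hjet]
  refine Submodule.sum_mem _ fun ρ _ => ?_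
  -- The adjoint of this operator sends 1 to the homotopy integral of `Eul ρ f`, which is zero, so
  -- the operator term is itself a divergence.
  have h := Op_sub_mem_range_divergence (relCoord hj (ρ, 0))
    ((gradAt ρ f).mapRange (homotopy hj 0) (map_zero _))
  rwa [Adj_one_mapRange (DD_homotopy hj hjet 0), ← Eul_apply, hf, map_zero, mul_zero,
    sub_zero] at h

theorem pd_dirU_baseFn (c : JetIdx n N) (w : ℝ × (Fin n → ℝ) → ℝ)
    (hw : ContDiffOn ℝ ∞ w (base (U : Set (Jet n N)))) :
    pd (dirU c) (baseFn w hw : DiffAlg U) = 0 := by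
  ext z
  rw [← (rep_baseFn w hw).partialU c z, partialU_base]
  rfl

/-- The Volterra-Vainberg Lagrangian of `Λ`. -/
def lagrangian (hj : IsCenter U j) (Λ : Fin N → DiffAlg U) : DiffAlg U :=
  ∑ ρ, relCoord hj (ρ, 0) * homotopy hj 0 (Λ ρ)

/-- If the linearization of `Λ` is self-adjoint, then `Λ` is the Euler-Lagrange expression of its
Volterra-Vainberg Lagrangian. -/
theorem Eul_lagrangian (hj : IsCenter U j) (hjet : ∀ i c, ∀ a ∈ base (U : Set (Jet n N)),
      fderiv ℝ (j c) a (indepDir i) = j (shift i c) a)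
    {Λ : Fin N → DiffAlg U} (hΛ : ∀ σ ρ, gradAt ρ (Λ σ) = adjCoef (gradAt σ (Λ ρ)))
    (σ : Fin N) : Eul σ (lagrangian hj Λ) = Λ σ := by
  -- By `Eul_mul` the variation splits in two. The factor u^ρ - v^ρ has linearization δ_{ρσ} and
  -- yields the first term of `eq_homotopy_add`.
  have h1 : ∑ ρ, Adj (homotopy hj 0 (Λ ρ)) (gradAt σ (relCoord hj (ρ, 0)))
      = homotopy hj 0 (Λ σ) := by
    have hg : ∀ ρ, gradAt σ (relCoord hj (ρ, 0))
        = if ρ = σ then Finsupp.single (0 : MIdx n) 1 else 0 := fun ρ => by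
      have h0 : gradAt σ (baseFn (j (ρ, 0)) (hj.smooth (ρ, 0)) : DiffAlg U) = 0 := by
        ext1 q
        exact pd_dirU_baseFn _ _ _
      rw [relCoord, map_sub, h0, sub_zero]
      exact gradAt_coordU σ ρ 0
    rw [Finset.sum_eq_single σ]
    · rw [hg, if_pos rfl, Adj_single, sgn_zero, one_smul, one_mul, DD_zero]
      rfl
    · intro ρ _ hρ
      rw [hg, if_neg hρ, map_zero]
    · exact fun h => absurd (Finset.mem_univ _) h
  -- Self-adjointness turns the adjoint linearization of `Λ ρ` into the linearization of `Λ σ`;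
  -- summed over ρ this is the velocity term of `eq_homotopy_add`.
  have h2 : ∀ ρ, Adj (relCoord hj (ρ, 0)) (gradAt σ (homotopy hj 0 (Λ ρ)))
      = Op (relCoord hj (ρ, 0)) ((gradAt ρ (Λ σ)).mapRange (homotopy hj 1) (map_zero _)) := by
    intro ρ
    have : gradAt σ (homotopy hj 0 (Λ ρ))
        = (gradAt σ (Λ ρ)).mapRange (homotopy hj 1) (map_zero _) := by
      ext1 q
      exact pd_dirU_homotopy hj 0 _ _
    rw [this, ← Op_adjCoef, adjCoef_mapRange (DD_homotopy hj hjet 1), hΛ σ ρ]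
  rw [lagrangian, map_sum]
  simp only [Eul_mul, Finset.sum_add_distrib]
  rw [h1, Finset.sum_congr rfl fun ρ _ => h2 ρ, ← linearCombination_relCoord_eq hj hjet]
  exact (eq_homotopy_add hj (Λ σ)).symm

end Exactness

/-! ### The properties of Λ in terms of the algebra -/

section Translation

open Topology TopologicalSpace

variable {U : Opens (Jet n N)}

/-- The differential functions which depend only on derivative coordinates in `A`. -/
def DependsOnly (U : Opens (Jet n N)) (A : Set (JetIdx n N)) : Subalgebra ℝ (DiffAlg U) where
  carrier := {f | ∃ S : Finset (JetIdx n N), (S : Set (JetIdx n N)) ⊆ A ∧ ∃ φ, IsRep U S φ f}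
  mul_mem' := by
    classical
    rintro f g ⟨S, hS, φ, hf⟩ ⟨S', hS', ψ, hg⟩
    have hf' := hf.mono (Finset.subset_union_left (s₂ := S'))
    have hg' := hg.mono (Finset.subset_union_right (s₁ := S))
    exact ⟨S ∪ S', by rw [Finset.coe_union]; exact Set.union_subset hS hS',
      _, hf'.1.mul hg'.1, fun z => congrArg₂ (· * ·) (hf'.2 z) (hg'.2 z)⟩
  add_mem' := by
    classical
    rintro f g ⟨S, hS, φ, hf⟩ ⟨S', hS', ψ, hg⟩
    have hf' := hf.mono (Finset.subset_union_left (s₂ := S'))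
    have hg' := hg.mono (Finset.subset_union_right (s₁ := S))
    exact ⟨S ∪ S', by rw [Finset.coe_union]; exact Set.union_subset hS hS',
      _, hf'.1.add hg'.1, fun z => congrArg₂ (· + ·) (hf'.2 z) (hg'.2 z)⟩
  algebraMap_mem' r := ⟨∅, by simp, fun _ => r, contDiffOn_const, fun _ => rfl⟩

/-- The derivative coordinates of order at most `p` without `t`-derivatives. -/
def spatialIdx (n N p : ℕ) : Set (JetIdx n N) := {c | c.2.1 = 0 ∧ order c.2.2 ≤ p}

theorem isSpatialDiffFun_iff {p : ℕ} {F : Jet n N → ℝ} :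
    IsSpatialDiffFun U p F ↔ ∃ f ∈ DependsOnly U (spatialIdx n N p), Rep F f := by
  constructor
  · rintro ⟨S, hS, φ, hφ, hF⟩
    have hrep : IsRep U S φ fun z => F z := ⟨hφ, fun z => hF z z.2⟩
    exact ⟨⟨fun z => F z, S, φ, hrep⟩, ⟨S, hS, φ, hrep⟩, fun _ => rfl⟩
  · rintro ⟨f, ⟨S, hS, φ, hφ, h⟩, hf⟩
    exact ⟨S, hS, φ, hφ, fun z hz => (hf ⟨z, hz⟩).trans (h ⟨z, hz⟩)⟩

theorem pd_eq_zero_of_dependsOnly {A : Set (JetIdx n N)} {f : DiffAlg U}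
    (hf : f ∈ DependsOnly U A) {c : JetIdx n N} (hc : c ∉ A) : pd (dirU c) f = 0 := by
  obtain ⟨S, hS, φ, h⟩ := hf
  exact h.pd_dirU_eq_zero fun h' => hc (hS h')

theorem spatial_of_dependsOnly {p : ℕ} {f : DiffAlg U}
    (hf : f ∈ DependsOnly U (spatialIdx n N p)) : f ∈ Spatial U := fun _ hc =>
  pd_eq_zero_of_dependsOnly hf fun h => hc h.1

/-- The contraction acts coordinate by coordinate over the base, so the homotopy brings in no new
derivative coordinates and the Lagrangian is free of t-derivatives. -/
theorem lagrangian_mem_dependsOnly {j : JetIdx n N → ℝ × (Fin n → ℝ) → ℝ} (hj : IsCenter U j)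
    {p : ℕ} {Λ : Fin N → DiffAlg U} (hΛ : ∀ σ, Λ σ ∈ DependsOnly U (spatialIdx n N p)) :
    lagrangian hj Λ ∈ DependsOnly U (spatialIdx n N p) := by
  refine Subalgebra.sum_mem _ fun ρ _ => Subalgebra.mul_mem _ (Subalgebra.sub_mem _ ?_ ?_) ?_
  · refine ⟨{(ρ, 0)}, ?_, fun y => y.2.2 ⟨(ρ, 0), Finset.mem_singleton_self _⟩,
      ContDiff.contDiffOn (by fun_prop), fun _ => rfl⟩
    rw [Finset.coe_singleton, Set.singleton_subset_iff]
    exact ⟨rfl, by simp [order]⟩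
  · exact ⟨∅, by simp, fun y => j (ρ, 0) (y.1, y.2.1),
      (hj.smooth _).comp (ContDiff.contDiffOn (by fun_prop)) fun _ => truncL_base_mem ∅,
      fun _ => rfl⟩
  · obtain ⟨S, hS, φ, h⟩ := hΛ ρ
    exact ⟨S, hS, _, isRep_homotopy hj 0 h⟩

theorem finsum_eq_sum_support {c : MIdx n →₀ DiffAlg U} (hc : ∀ q : MIdx n, q.1 ≠ 0 → c q = 0)
    (a : MIdx n → ℝ) (ha : ∀ q, c q = 0 → a q = 0) :
    ∑ᶠ I : Fin n → ℕ, a (0, I) = ∑ q ∈ c.support, a q := by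
  classical
  have h0 : ∀ q ∈ c.support, q = (0, q.2) := fun q hq => by
    refine Prod.ext ?_ rfl
    by_contra h
    exact Finsupp.mem_support_iff.1 hq (hc q h)
  rw [finsum_eq_sum_of_support_subset (s := c.support.image Prod.snd), Finset.sum_image]
  · exact Finset.sum_congr rfl fun q hq => by rw [← h0 q hq]
  · intro q hq r hr h
    rw [h0 q hq, h0 r hr, h]
  · intro I hI
    rw [Finset.coe_image]
    exact ⟨(0, I), Finsupp.mem_support_iff.2 fun h => hI (ha _ h), rfl⟩

theorem gradAt_eq_zero {f : DiffAlg U} (hf : f ∈ Spatial U) (ρ : Fin N) (q : MIdx n)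
    (hq : q.1 ≠ 0) : gradAt ρ f q = 0 := hf (ρ, q) hq

theorem Rep.lin {F V : Jet n N → ℝ} {f v : DiffAlg U} (hF : Rep F f) (hf : f ∈ Spatial U)
    (hV : Rep V v) (ρ : Fin N) : Rep (lin F ρ V) (Op v (gradAt ρ f)) := fun z => by
  rw [Op_apply, ← evalAt_apply, map_sum,
    ← finsum_eq_sum_support (gradAt_eq_zero hf ρ) (fun q => evalAt z (gradAt ρ f q * DD q v))
      fun q hq => by rw [hq, zero_mul, map_zero]]
  exact finsum_congr fun I => congrArg₂ (· * ·) (hF.partialU _ z) (hV.totalXs I z)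

theorem evalAt_smul (z : U) (r : ℝ) (f : DiffAlg U) : evalAt z (r • f) = r * evalAt z f :=
  map_smul (evalAt z) r f

theorem sgn_zero_left (I : Fin n → ℕ) : sgn ((0, I) : MIdx n) = (-1) ^ order I := by
  rw [sgn, zero_add]

theorem Rep.adlin {F W : Jet n N → ℝ} {f w : DiffAlg U} (hF : Rep F f) (hf : f ∈ Spatial U)
    (hW : Rep W w) (ρ : Fin N) : Rep (adlin F ρ W) (Adj w (gradAt ρ f)) := fun z => by
  rw [Adj_apply, ← evalAt_apply, map_sum,
    ← finsum_eq_sum_support (gradAt_eq_zero hf ρ)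
      (fun q => evalAt z (sgn q • DD q (gradAt ρ f q * w)))
      fun q hq => by rw [hq, zero_mul, map_zero, smul_zero, map_zero]]
  refine finsum_congr fun I => ?_
  rw [evalAt_smul, sgn_zero_left]
  exact congrArg _ (((hF.partialU (ρ, 0, I)).mul hW).totalXs I z)

theorem Rep.euler {F : Jet n N → ℝ} {f : DiffAlg U} (hF : Rep F f) (hf : f ∈ Spatial U)
    (σ : Fin N) : Rep (euler σ F) (Eul σ f) := fun z => by
  rw [Eul_apply, Adj_apply, ← evalAt_apply, map_sum,
    ← finsum_eq_sum_support (gradAt_eq_zero hf σ)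
      (fun q => evalAt z (sgn q • DD q (gradAt σ f q * 1)))
      fun q hq => by rw [hq, zero_mul, map_zero, smul_zero, map_zero]]
  refine finsum_congr fun I => ?_
  rw [evalAt_smul, sgn_zero_left, mul_one]
  exact congrArg _ ((hF.partialU (σ, 0, I)).totalXs I z)

theorem Rep.solT {G : Fin N → Jet n N → ℝ} {g : Fin N → DiffAlg U} {F : Jet n N → ℝ}
    {f : DiffAlg U} (hG : ∀ ρ, Rep (G ρ) (g ρ)) (hF : Rep F f) (hf : f ∈ Spatial U) :
    Rep (solT G F) (solD g f) := fun z => by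
  rw [solD, ← evalAt_apply, map_sub, map_sum]
  refine congrArg₂ (· - ·) (hF.partialT z) (Finset.sum_congr rfl fun ρ _ => ?_)
  rw [evalAt_apply, ← hF.lin hf (hG ρ) ρ z]
  exact finsum_congr fun I => mul_comm _ _

theorem isAdjointSymmetry_iff {G L : Fin N → Jet n N → ℝ} {g Λ : Fin N → DiffAlg U}
    (hG : ∀ σ, Rep (G σ) (g σ)) (hL : ∀ σ, Rep (L σ) (Λ σ)) (hg : ∀ σ, g σ ∈ Spatial U)
    (hΛ : ∀ σ, Λ σ ∈ Spatial U) :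
    IsAdjointSymmetry U G L ↔ ∀ σ, -solD g (Λ σ) + ∑ ρ, Adj (Λ ρ) (gradAt σ (g ρ)) = 0 := by
  refine forall_congr' fun σ => ?_
  have h : ∀ z : U, -solT G (L σ) z + ∑ ρ, adlin (G ρ) σ (L ρ) z
      = (-solD g (Λ σ) + ∑ ρ, Adj (Λ ρ) (gradAt σ (g ρ)) : DiffAlg U).toFun z := fun z => by
    rw [← evalAt_apply, map_add, map_neg, map_sum, evalAt_apply, ← Rep.solT hG (hL σ) (hΛ σ) z]
    exact congrArg _ (Finset.sum_congr rfl fun ρ _ => (hG ρ).adlin (hg ρ) (hL ρ) σ z)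
  constructor
  · intro H
    ext z
    rw [← h z, H z z.2]
    rfl
  · intro H z hz
    rw [h ⟨z, hz⟩, H]
    rfl

theorem isMultiplier_iff {G L : Fin N → Jet n N → ℝ} {g Λ : Fin N → DiffAlg U}
    (hG : ∀ σ, Rep (G σ) (g σ)) (hL : ∀ σ, Rep (L σ) (Λ σ)) :
    IsMultiplier U G L ↔
      ∑ ρ, (coordT ρ + g ρ) * Λ ρ ∈ LinearMap.range (divergence (U := U)) := by
  have hprod : Rep (fun z => ∑ σ, (z.2.2 (σ, 1, 0) + G σ z) * L σ z)
      (∑ ρ, (coordT ρ + g ρ) * Λ ρ) :=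
    Rep.sum _ fun σ => ((rep_coordU (σ, 1, 0)).add (hG σ)).mul (hL σ)
  constructor
  · rintro ⟨Φt, Φ, hΦt, hΦ, h⟩
    obtain ⟨φt, hφt⟩ := isDiffFun_iff.1 hΦt
    choose φ hφ using fun i => isDiffFun_iff.1 (hΦ i)
    refine ⟨fun o => o.elim φt φ, ?_⟩
    ext z
    rw [divergence_apply, Fintype.sum_option, ← hprod z]
    beta_reduce
    rw [h z z.2]
    exact ((hφt.totalT.add (Rep.sum _ fun i => (hφ i).totalX i)) z).symm
  · rintro ⟨φ, hφ⟩
    refine ⟨extZ (φ none).toFun, fun i => extZ (φ (some i)).toFun, (rep_extZ _).isDiffFun,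
      fun i => (rep_extZ _).isDiffFun, fun z hz => ?_⟩
    refine (hprod ⟨z, hz⟩).trans ?_
    rw [← hφ, divergence_apply, Fintype.sum_option]
    exact (((rep_extZ (φ none)).totalT.add (Rep.sum _ fun i =>
      (rep_extZ (φ (some i))).totalX i)) ⟨z, hz⟩).symm

theorem hasSelfAdjointLin_iff {L : Fin N → Jet n N → ℝ} {Λ : Fin N → DiffAlg U}
    (hL : ∀ σ, Rep (L σ) (Λ σ)) (hΛ : ∀ σ, Λ σ ∈ Spatial U) :
    HasSelfAdjointLin U L ↔ ∀ σ ρ, gradAt ρ (Λ σ) = adjCoef (gradAt σ (Λ ρ)) := by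
  refine forall_congr' fun σ => forall_congr' fun ρ => ?_
  rw [← Op_eq_Adj_iff ρ]
  constructor
  · intro H v
    ext z
    rw [← (hL σ).lin (hΛ σ) (rep_extZ v) ρ z, ← (hL ρ).adlin (hΛ ρ) (rep_extZ v) σ z]
    exact H _ (rep_extZ v).isDiffFun z z.2
  · intro H V hV z hz
    obtain ⟨v, hv⟩ := isDiffFun_iff.1 hV
    rw [(hL σ).lin (hΛ σ) hv ρ ⟨z, hz⟩, (hL ρ).adlin (hΛ ρ) hv σ ⟨z, hz⟩, H v]

theorem isVariational_iff {j : JetIdx n N → ℝ × (Fin n → ℝ) → ℝ} (hj : IsCenter U j)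
    (hjet : ∀ i c, ∀ a ∈ base (U : Set (Jet n N)), fderiv ℝ (j c) a (indepDir i) = j (shift i c) a)
    {p : ℕ} {L : Fin N → Jet n N → ℝ} {Λ : Fin N → DiffAlg U} (hL : ∀ σ, Rep (L σ) (Λ σ))
    (hΛ : ∀ σ, Λ σ ∈ DependsOnly U (spatialIdx n N p)) :
    IsVariational U L ↔ ∀ σ ρ, gradAt ρ (Λ σ) = adjCoef (gradAt σ (Λ ρ)) := by
  constructor
  · rintro ⟨k, P, hP, h⟩ σ ρ
    obtain ⟨f, hf, hPf⟩ := isSpatialDiffFun_iff.1 hP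
    have hE : ∀ σ, Λ σ = Eul σ f := fun σ => by
      ext z
      rw [← hL σ z, h σ z z.2, hPf.euler (spatial_of_dependsOnly hf) σ z]
    rw [← Op_eq_Adj_iff ρ, hE, hE]
    exact fun V => Op_gradAt_Eul V f σ ρ
  · intro h
    have hP := lagrangian_mem_dependsOnly hj hΛ
    refine ⟨p, extZ (lagrangian hj Λ).toFun,
      isSpatialDiffFun_iff.2 ⟨_, hP, rep_extZ _⟩, fun σ z hz => ?_⟩
    rw [(rep_extZ (lagrangian hj Λ)).euler (spatial_of_dependsOnly hP) σ ⟨z, hz⟩,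
      Eul_lagrangian hj hjet h σ]
    exact hL σ ⟨z, hz⟩

theorem binom_add_left (I J : Fin n → ℕ) :
    (binom ((0, I + J) : MIdx n) (0, I) : ℝ) = ∏ i, ((I i + J i).choose (I i) : ℝ) := by
  rw [binom, Fintype.prod_option, Nat.cast_mul, Nat.cast_prod]
  simp [MIdx.comp]

/-- Substitute q = I + J in `adjCoef_apply`: the binomials vanish unless q ≥ I, and the sign
(-1)^|I+J| splits off (-1)^|I|. -/
theorem finsum_adjCoef {F : Jet n N → ℝ} {f : DiffAlg U} (hF : Rep F f) (hf : f ∈ Spatial U)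
    (σ : Fin N) (I : Fin n → ℕ) (z : U) :
    ∑ᶠ J : Fin n → ℕ, (-1) ^ order J * (∏ i, ((I i + J i).choose (I i) : ℝ)) *
        totalXs J (partialU (σ, 0, I + J) F) z
      = (-1) ^ order I * (adjCoef (gradAt σ f) (0, I)).toFun z := by
  set b : MIdx n → ℝ := fun q =>
    evalAt z ((sgn q * binom q (0, I)) • DD (q - (0, I)) (gradAt σ f q)) with hb
  have h1 : (adjCoef (gradAt σ f) (0, I)).toFun z = ∑ᶠ J : Fin n → ℕ, b (0, I + J) := by
    rw [adjCoef_apply, ← evalAt_apply, map_sum, ← finsum_eq_sum_support (gradAt_eq_zero hf σ) b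
      fun q hq => by rw [hb]; simp only [hq, map_zero, smul_zero]]
    rw [← finsum_mem_range (f := fun K => b (0, K)) (add_right_injective I), finsum_mem_def,
      Set.indicator_eq_self.2]
    intro K hK
    by_contra hKI
    refine hK ?_
    have : ¬((0, I) : MIdx n) ≤ (0, K) := fun h => hKI ⟨K - I, add_tsub_cancel_of_le h.2⟩
    simp only [hb, binom_eq_zero this, Nat.cast_zero, mul_zero, zero_smul, map_zero]
  have hsq : ((-1 : ℝ) ^ order I) * (-1) ^ order I = 1 := by rw [← mul_pow]; simp
  have h2 : ∀ J : Fin n → ℕ, (-1) ^ order J * (∏ i, ((I i + J i).choose (I i) : ℝ)) *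
        totalXs J (partialU (σ, 0, I + J) F) z = (-1) ^ order I * b (0, I + J) := by
    intro J
    have hsgn : sgn ((0, I + J) : MIdx n) = (-1) ^ order I * (-1) ^ order J := by
      rw [← sgn_zero_left, ← sgn_zero_left, ← sgn_add]
      rfl
    have hsub : ((0, I + J) : MIdx n) - (0, I) = (0, J) :=
      Prod.ext rfl (add_tsub_cancel_left I J)
    rw [hb]
    simp only
    rw [evalAt_smul, hsub, hsgn, binom_add_left, (hF.partialU (σ, 0, I + J)).totalXs J z,
      evalAt_apply, gradAt_apply]
    linear_combination (-(-1) ^ order J * (∏ i, ((I i + J i).choose (I i) : ℝ))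
      * (DD (0, J) (pd (dirU (σ, 0, I + J)) f)).toFun z) * hsq
  rw [finsum_congr h2, h1]
  exact (smul_finsum ((-1 : ℝ) ^ order I) fun J => b (0, I + J)).symm

theorem extraDetEqs_iff {p : ℕ} {L : Fin N → Jet n N → ℝ} {Λ : Fin N → DiffAlg U}
    (hL : ∀ σ, Rep (L σ) (Λ σ)) (hΛ : ∀ σ, Λ σ ∈ DependsOnly U (spatialIdx n N p)) :
    ExtraDetEqs U p L ↔ ∀ σ ρ, gradAt ρ (Λ σ) = adjCoef (gradAt σ (Λ ρ)) := by
  have hS : ∀ σ, Λ σ ∈ Spatial U := fun σ => spatial_of_dependsOnly (hΛ σ)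
  have key : ∀ σ ρ (I : Fin n → ℕ) (z : U),
      (-1) ^ (order I + 1) * partialU (ρ, 0, I) (L σ) z +
        ∑ᶠ J : Fin n → ℕ, (-1) ^ order J * (∏ i, ((I i + J i).choose (I i) : ℝ)) *
          totalXs J (partialU (σ, 0, I + J) (L ρ)) z = 0
        ↔ (gradAt ρ (Λ σ) (0, I)).toFun z = (adjCoef (gradAt σ (Λ ρ)) (0, I)).toFun z := by
    intro σ ρ I z
    rw [finsum_adjCoef (hL ρ) (hS ρ), (hL σ).partialU _ z, pow_succ, gradAt_apply, mul_neg_one,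
      neg_mul, neg_add_eq_zero]
    exact mul_right_inj' (pow_ne_zero _ (by norm_num))
  constructor
  · intro H σ ρ
    ext1 ⟨k, I⟩
    by_cases hk : k = 0
    · subst hk
      by_cases hI : order I ≤ p
      · ext z
        exact (key σ ρ I z).1 (H σ ρ I hI z z.2)
      -- The identity is automatic above order `p`: the left side is zero, and a term on the right
      -- needs some q ≥ I of order at most `p` in the support.
      · rw [gradAt_apply, pd_eq_zero_of_dependsOnly (hΛ σ) fun h => hI h.2, adjCoef_apply]
        refine (Finset.sum_eq_zero fun q hq => ?_).symm
        rw [binom_eq_zero, Nat.cast_zero, mul_zero, zero_smul]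
        intro hle
        refine Finsupp.mem_support_iff.1 hq (pd_eq_zero_of_dependsOnly (hΛ ρ) fun h => hI ?_)
        exact (Finset.sum_le_sum fun i _ => hle.2 i).trans h.2
    · rw [adjCoef_eq_zero (hS ρ) hk]
      exact hS σ _ hk
  · intro H σ ρ I _ z hz
    exact (key σ ρ I ⟨z, hz⟩).2 (by rw [H σ ρ])

/-- The centre is the jet of `v`. Star-shaped fibres give invariance under the contraction, and
`rep_jetOf` gives compatibility with differentiation. -/
theorem exists_isCenter (hU : IsStarDomain (U : Set (Jet n N))) :
    ∃ j : JetIdx n N → ℝ × (Fin n → ℝ) → ℝ, IsCenter U j ∧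
      ∀ i c, ∀ a ∈ base (U : Set (Jet n N)), fderiv ℝ (j c) a (indepDir i) = j (shift i c) a := by
  obtain ⟨-, -, v, hv, hstar⟩ := hU
  have hrep := rep_jetOf (U := U) fun σ => rep_baseFn (v σ) (hv σ)
  have hsm : ∀ c, ContDiffOn ℝ ∞ (fun a => jetOf v a c) (base (U : Set (Jet n N))) := fun c =>
    contDiffOn_of_rep (w := fun a => jetOf v a c) (hrep c)
  refine ⟨fun c a => jetOf v a c, ⟨hsm, fun s hs z hz => ?_⟩, ?_⟩
  · have h := (hstar (z.1, z.2.1) ⟨z, hz, rfl⟩).add_smul_sub_mem (y := z.2.2) hz hs.1 hs.2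
    exact h
  · rintro i c _ ⟨z, hz, rfl⟩
    rw [← D_baseFn_apply i _ (hsm c) ⟨z, hz⟩]
    have h1 : (baseFn (fun a => jetOf v a c) (hsm c) : DiffAlg U)
        = DD c.2 (baseFn (v c.1) (hv c.1)) := by
      ext y
      exact hrep c y
    rw [h1, ← DD_add_unit]
    exact (hrep (shift i c) ⟨z, hz⟩).symm

end Translation

end CauchyKovalevskaya

end

/-! ### The theorem -/

open CauchyKovalevskaya
theorem corollary2p7 (n N m p : ℕ) (U : Set (Jet n N)) (hU : IsStarDomain U)
    (g Λ : Fin N → Jet n N → ℝ)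
    (hg : ∀ σ, IsSpatialDiffFun U m (g σ)) (hΛ : ∀ σ, IsSpatialDiffFun U p (Λ σ)) :
    (IsMultiplier U g Λ ↔ IsAdjointSymmetry U g Λ ∧ IsVariational U Λ) ∧
    (IsMultiplier U g Λ ↔ IsAdjointSymmetry U g Λ ∧ HasSelfAdjointLin U Λ) ∧
    (IsVariational U Λ ↔ HasSelfAdjointLin U Λ) ∧
    (HasSelfAdjointLin U Λ ↔ ExtraDetEqs U p Λ) := by
  lift U to TopologicalSpace.Opens (Jet n N) using hU.1
  obtain ⟨j, hj, hjet⟩ := exists_isCenter hU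
  obtain ⟨a₀, -, hstar⟩ := hU.2.1
  choose g' hg' hgr using fun σ => isSpatialDiffFun_iff.1 (hg σ)
  choose L hL hLr using fun σ => isSpatialDiffFun_iff.1 (hΛ σ)
  have hgS := fun σ => spatial_of_dependsOnly (hg' σ)
  have hLS := fun σ => spatial_of_dependsOnly (hL σ)
  have hV := isVariational_iff hj hjet hLr hL
  have hH := hasSelfAdjointLin_iff hLr hLS
  have hM : IsMultiplier U g Λ ↔ IsAdjointSymmetry U g Λ ∧
      ∀ σ ρ, gradAt ρ (L σ) = adjCoef (gradAt σ (L ρ)) := by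
    rw [isMultiplier_iff hgr hLr, isAdjointSymmetry_iff hgr hLr hgS hLS,
      ← Eul_sum_mul_eq_zero_iff hgS hLS]
    -- Being a total divergence is the same as lying in the kernel of every Euler operator; only the
    -- direction proved here needs the star-shaped domain.
    refine ⟨?_, fun h => mem_range_divergence_of_Eul_eq_zero hj hjet hstar h⟩
    rintro ⟨Φ, hΦ⟩ σ
    rw [← hΦ, Eul_divergence]
  -- Variationality, self-adjointness and the extra equations have all become the same coefficient
  -- identity.
  rw [hM, hV, hH, extraDetEqs_iff hLr hL]
  exact ⟨Iff.rfl, Iff.rfl, Iff.rfl, Iff.rfl⟩
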